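/- Let $(\mathscr A,\mathscr B,\mathscr C)$ be a recollement of abelian categories, i.e. functors $\mathsf i\colon\mathscr A\to\mathscr B$, $\mathsf q,\mathsf p\colon\mathscr B\to\mathscr A$, $\mathsf e\colon\mathscr B\to\mathscr C$, $\mathsf l,\mathsf r\colon\mathscr C\to\mathscr B$ such that $(\mathsf q,\mathsf i,\mathsf p)$ and $(\mathsf l,\mathsf e,\mathsf r)$ are adjoint triples, $\mathsf i,\mathsf l,\mathsf r$ are fully faithful and the essential image of $\mathsf i$ is $\operatorname{Ker}\mathsf e$. Put $\mathsf l^0=\mathsf l$ and $\mathsf r^0=\mathsf r$. The recollement has a ladder of $\mathsf l$-height $n$ if there are functors $\mathsf l^1,\dots,\mathsf l^{n-1}$ (alternately $\mathscr B\to\mathscr C$ and $\mathscr C\to\mathscr B$) such that $\mathsf l^{i+1}$ is left adjoint to $\mathsf l^i$ for $0\le i\le n-2$, and a ladder of $\mathsf r$-height $n$ if there are functors $\mathsf r^1,\dots,\mathsf r^{n-1}$ such that $\mathsf r^{i+1}$ is right adjoint to $\mathsf r^i$ for $0\le i\le n-2$. Let $\mathsf D$ and $\mathsf D^{\mathsf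 b}$ denote the unbounded and the bounded derived category, let $\mathsf D_{\mathsf{sg}}(\mathscr B)=\mathsf D^{\mathsf b}(\mathscr B)/\mathsf K^{\mathsf b}(\operatorname{Proj}\mathscr B)$ be the singularity category, let $\mathsf D_{\mathscr A}(\mathscr B)\subseteq\mathsf D(\mathscr B)$ be the full subcategory of complexes whose cohomologies lie in $\mathsf i(\mathscr A)$, and let $\mathsf D^{\mathsf b}_{\mathscr A}(\mathscr B)$ be its intersection with $\mathsf D^{\mathsf b}(\mathscr B)$. A recollement $(\mathcal S,\mathcal T,\mathcal U)$ of triangulated categories consists of six triangle functors $i\colon\mathcal S\to\mathcal T$, $q,p\colon\mathcal T\to\mathcal S$, $e\colon\mathcal T\to\mathcal U$, $l,r\colon\mathcal U\to\mathcal T$ with the same three properties as above. An exact functor, respectively an exact functor which preserves projective objects, is denoted by the same letter as the triangle functor which it induces on $\mathsf D$ and $\mathsf D^{\mathsf b}$, respectively on $\mathsf D_{\mathsf{sg}}$; whenever a functor between abelian categories appears below on a derived or singularity category, it has these properties. (i) Assume that $(\mathscr A,\mathscr B,\mathscr C)$ has a ladder of $\mathsf l$-height three. Then $\mathsf l^1$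 induces a triangle equivalence $\mathsf D_{\mathsf{sg}}(\mathscr B)/\operatorname{Ker}\mathsf l^1\simeq\mathsf D_{\mathsf{sg}}(\mathscr C)$, where $\operatorname{Ker}\mathsf l^1$ is the kernel of $\mathsf l^1\colon\mathsf D_{\mathsf{sg}}(\mathscr B)\to\mathsf D_{\mathsf{sg}}(\mathscr C)$. Moreover there is a recollement of triangulated categories $(\mathsf D(\mathscr C),\mathsf D(\mathscr B),\mathsf D_{\mathscr A}(\mathscr B))$ whose functors between $\mathsf D(\mathscr C)$ and $\mathsf D(\mathscr B)$ are the adjoint triple $(\mathsf l^1,\mathsf l^0,\mathsf e)$ and in which the right adjoint of $\mathsf D(\mathscr B)\to\mathsf D_{\mathscr A}(\mathscr B)$ is the inclusion. It restricts to a recollement $(\mathsf D^{\mathsf b}(\mathscr C),\mathsf D^{\mathsf b}(\mathscr B),\mathsf D^{\mathsf b}_{\mathscr A}(\mathscr B))$ of bounded derived categories. (ii) Assume that $(\mathscr A,\mathscr B,\mathscr C)$ has a ladder of $\mathsf l$-height three and $\mathsf r$-height two. Then $(\mathsf l^1,\mathsf l^0,\mathsf e)$ induces an adjoint triple between $\mathsf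 D_{\mathsf{sg}}(\mathscr B)$ and $\mathsf D_{\mathsf{sg}}(\mathscr C)$, and there is a recollement of triangulated categories $(\mathsf D_{\mathsf{sg}}(\mathscr C),\mathsf D_{\mathsf{sg}}(\mathscr B),\operatorname{Ker}\mathsf l^1)$ whose functors between $\mathsf D_{\mathsf{sg}}(\mathscr C)$ and $\mathsf D_{\mathsf{sg}}(\mathscr B)$ are this triple and in which the left adjoint of $\mathsf D_{\mathsf{sg}}(\mathscr B)\to\operatorname{Ker}\mathsf l^1$ is the inclusion. (iii) Assume that $(\mathscr A,\mathscr B,\mathscr C)$ has a ladder of $\mathsf l$-height four. Then there is a recollement of triangulated categories $(\operatorname{Ker}\mathsf l^1,\mathsf D_{\mathsf{sg}}(\mathscr B),\mathsf D_{\mathsf{sg}}(\mathscr C))$ in which $\operatorname{Ker}\mathsf l^1\to\mathsf D_{\mathsf{sg}}(\mathscr B)$ is the inclusion and the functors between $\mathsf D_{\mathsf{sg}}(\mathscr B)$ and $\mathsf D_{\mathsf{sg}}(\mathscr C)$ are the adjoint triple $(\mathsf l^2,\mathsf l^1,\mathsf l^0)$. If the given ladder moreover has $\mathsf r$-height two,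 then this recollement has a ladder of height two: it can be continued downwards by one more row of adjoints, consisting of the right adjoint $\mathsf e\colon\mathsf D_{\mathsf{sg}}(\mathscr B)\to\mathsf D_{\mathsf{sg}}(\mathscr C)$ of $\mathsf l^0$ and of a right adjoint of the functor $\mathsf D_{\mathsf{sg}}(\mathscr B)\to\operatorname{Ker}\mathsf l^1$ right adjoint to the inclusion, so that the three lower rows form a recollement $(\mathsf D_{\mathsf{sg}}(\mathscr C),\mathsf D_{\mathsf{sg}}(\mathscr B),\operatorname{Ker}\mathsf l^1)$. (iv) Assume that $(\mathscr A,\mathscr B,\mathscr C)$ has a ladder of $\mathsf r$-height three. Then $\mathsf e$ induces a triangle equivalence $\mathsf D_{\mathsf{sg}}(\mathscr B)/\operatorname{Ker}\mathsf e\simeq\mathsf D_{\mathsf{sg}}(\mathscr C)$, where $\operatorname{Ker}\mathsf e$ is the kernel of $\mathsf e\colon\mathsf D_{\mathsf{sg}}(\mathscr B)\to\mathsf D_{\mathsf{sg}}(\mathscr C)$. -/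

import Mathlib

open CategoryTheory Limits Triangulated
open scoped ZeroObject Pretriangulated

set_option linter.unusedSectionVars false

universe w₁ w₂ v₁ v₂ v₃ u₁ u₂ u₃

noncomputable section

namespace LadderRecollement

/-! ## Triangle functors, kernels, Verdier quotients, recollements of triangulated categories -/

section Triangulated

variable (S : Type u₁) [Category.{v₁} S] [HasZeroObject S] [HasShift S ℤ] [Preadditive S]
  [∀ n : ℤ, (shiftFunctor S n).Additive] [Pretriangulated S]
  (T : Type u₂) [Category.{v₂} T] [HasZeroObject T] [HasShift T ℤ] [Preadditive T]
  [∀ n : ℤ, (shiftFunctor T n).Additive] [Pretriangulated T]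
  (U : Type u₃) [Category.{v₃} U] [HasZeroObject U] [HasShift U ℤ] [Preadditive U]
  [∀ n : ℤ, (shiftFunctor U n).Additive] [Pretriangulated U]

/-- A triangle functor: a functor together with natural isomorphisms expressing the
commutation with the shifts, which sends distinguished triangles to distinguished triangles. -/
structure TriangleFunctor where
  /-- the underlying functor -/
  functor : S ⥤ T
  /-- the commutation with the shifts -/
  commShift : functor.CommShift ℤ
  isTriangulated : functor.IsTriangulated

attribute [instance] TriangleFunctor.commShift TriangleFunctor.isTriangulated

/-- A recollement of triangulated categories: triangle functors
`q, p : T ⥤ S`, `i : S ⥤ T`, `l, r : U ⥤ T`, `e : T ⥤ U` such that `(q, i, p)` and `(l, e, r)`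
are adjoint triples, `i`, `l`, `r` are fully faithful and the essential image of `i` is the
kernel of `e`. -/
structure TriangulatedRecollement where
  /-- the functor `S ⥤ T` -/
  i : TriangleFunctor S T
  /-- the left adjoint of `i` -/
  q : TriangleFunctor T S
  /-- the right adjoint of `i` -/
  p : TriangleFunctor T S
  /-- the functor `T ⥤ U` -/
  e : TriangleFunctor T U
  /-- the left adjoint of `e` -/
  l : TriangleFunctor U T
  /-- the right adjoint of `e` -/
  r : TriangleFunctor U T
  adj_q_i : Nonempty (q.functor ⊣ i.functor)
  adj_i_p : Nonempty (i.functor ⊣ p.functor)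
  adj_l_e : Nonempty (l.functor ⊣ e.functor)
  adj_e_r : Nonempty (e.functor ⊣ r.functor)
  i_full : i.functor.Full
  i_faithful : i.functor.Faithful
  l_full : l.functor.Full
  l_faithful : l.functor.Faithful
  r_full : r.functor.Full
  r_faithful : r.functor.Faithful
  essImage_i_iff : ∀ X : T, i.functor.essImage X ↔ IsZero (e.functor.obj X)

variable {S T U}

namespace TriangleFunctor

/-- Isomorphism of triangle functors. -/
def Isomorphic (F G : TriangleFunctor S T) : Prop :=
  ∃ φ : F.functor ≅ G.functor, NatTrans.CommShift φ.hom ℤ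

/-- Composition of triangle functors. -/
def comp (F : TriangleFunctor S T) (G : TriangleFunctor T U) : TriangleFunctor S U where
  functor := F.functor ⋙ G.functor
  commShift := inferInstance
  isTriangulated := inferInstance

/-- The kernel of a triangle functor: the objects which are sent to zero objects. -/
def kernel (F : TriangleFunctor S T) : ObjectProperty S := fun X => IsZero (F.functor.obj X)

instance (F : TriangleFunctor S T) : F.kernel.IsClosedUnderIsomorphisms where
  of_iso e hX := hX.of_iso (F.functor.mapIso e.symm)

instance (F : TriangleFunctor S T) : F.kernel.IsTriangulated where
  exists_zero := ⟨0, isZero_zero S, F.functor.map_isZero (isZero_zero S)⟩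
  isStableUnderShiftBy n :=
    { le_shift := fun X hX =>
        ((shiftFunctor T n).map_isZero hX).of_iso ((F.functor.commShiftIso n).app X) }
  toIsTriangulatedClosed₂ := .mk' (fun _ hT h₁ h₃ =>
    Pretriangulated.Triangle.isZero₂_of_isZero₁₃ _ (F.functor.map_distinguished _ hT) h₁ h₃)

/-- The inclusion of a full triangulated subcategory. -/
def inclusion (P : ObjectProperty S) [P.IsTriangulated] :
    TriangleFunctor P.FullSubcategory S where
  functor := P.ι
  commShift := inferInstance
  isTriangulated := inferInstance

/-- The restriction of a triangle functor to full triangulated subcategories. -/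
def restrict (F : TriangleFunctor S T) (P : ObjectProperty S) [P.IsTriangulated]
    (Q : ObjectProperty T) [Q.IsTriangulated] (h : ∀ X, P X → Q (F.functor.obj X)) :
    TriangleFunctor P.FullSubcategory Q.FullSubcategory where
  functor := Q.lift (P.ι ⋙ F.functor) (fun X => h _ X.property)
  commShift := inferInstance
  isTriangulated := inferInstance

end TriangleFunctor

section VerdierQuotient

variable [IsTriangulated S] [IsTriangulated T]

/-- The Verdier quotient of a triangulated category by a full triangulated subcategory: the
localization with respect to the morphisms whose cone belongs to the subcategory. -/
abbrev VerdierQuotient (P : ObjectProperty S) [P.IsTriangulated] := P.trW.Localization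

namespace TriangleFunctor

/-- The quotient functor. -/
def quotient (P : ObjectProperty S) [P.IsTriangulated] :
    TriangleFunctor S (VerdierQuotient P) where
  functor := P.trW.Q
  commShift := inferInstance
  isTriangulated := inferInstance

/-- If `F` sends `P` to `Q`, it sends `P.trW` to `Q.trW`. -/
def localizerMorphism (F : TriangleFunctor S T) (P : ObjectProperty S) (Q : ObjectProperty T)
    (h : ∀ X, P X → Q (F.functor.obj X)) : LocalizerMorphism P.trW Q.trW where
  functor := F.functor
  map := by
    rintro X Y f ⟨Z, g, k, hT, hZ⟩
    exact ⟨_, _, _, F.functor.map_distinguished _ hT, h _ hZ⟩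

instance (F : TriangleFunctor S T) (P : ObjectProperty S) (Q : ObjectProperty T)
    (h : ∀ X, P X → Q (F.functor.obj X)) :
    (F.localizerMorphism P Q h).functor.CommShift ℤ := F.commShift

/-- The triangle functor between Verdier quotients which is induced by a triangle functor. -/
def onQuotients (F : TriangleFunctor S T) (P : ObjectProperty S) [P.IsTriangulated]
    (Q : ObjectProperty T) [Q.IsTriangulated] (h : ∀ X, P X → Q (F.functor.obj X)) :
    TriangleFunctor (VerdierQuotient P) (VerdierQuotient Q) where
  functor := (F.localizerMorphism P Q h).localizedFunctor P.trW.Q Q.trW.Q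
  commShift := inferInstance
  isTriangulated := by
    have : P.trW.Q.mapArrow.EssSurj := Localization.essSurj_mapArrow P.trW.Q P.trW
    have : (F.localizerMorphism P Q h).functor.IsTriangulated := F.isTriangulated
    have : NatTrans.CommShift (CatCommSq.iso (F.localizerMorphism P Q h).functor P.trW.Q Q.trW.Q
        ((F.localizerMorphism P Q h).localizedFunctor P.trW.Q Q.trW.Q)).symm.hom ℤ :=
      inferInstanceAs (NatTrans.CommShift (CatCommSq.iso (F.localizerMorphism P Q h).functor
        P.trW.Q Q.trW.Q ((F.localizerMorphism P Q h).localizedFunctor P.trW.Q Q.trW.Q)).inv ℤ)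
    exact Functor.isTriangulated_of_precomp_iso
      (CatCommSq.iso (F.localizerMorphism P Q h).functor P.trW.Q Q.trW.Q
        ((F.localizerMorphism P Q h).localizedFunctor P.trW.Q Q.trW.Q)).symm

/-- The triangle functor `F : S ⥤ T` induces a triangle equivalence from the
Verdier quotient of `S` by the kernel of `F` to `T`. -/
def InducesVerdierEquivalence (F : TriangleFunctor S T) : Prop :=
  ∃ E : TriangleFunctor (VerdierQuotient F.kernel) T,
    E.functor.IsEquivalence ∧ ((quotient F.kernel).comp E).Isomorphic F

end TriangleFunctor

end VerdierQuotient

namespace TriangulatedRecollement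

/-- The recollement `(S, T, U)` restricts to full triangulated subcategories of `S`, `T`, `U`:
the six functors restrict to functors between these subcategories, and the restricted functors
are the functors of a recollement. -/
def RestrictsTo (R : TriangulatedRecollement S T U) (PS : ObjectProperty S) [PS.IsTriangulated]
    (PT : ObjectProperty T) [PT.IsTriangulated] (PU : ObjectProperty U) [PU.IsTriangulated] :
    Prop :=
  ∃ (hi : ∀ X, PS X → PT (R.i.functor.obj X)) (hq : ∀ X, PT X → PS (R.q.functor.obj X))
    (hp : ∀ X, PT X → PS (R.p.functor.obj X)) (he : ∀ X, PT X → PU (R.e.functor.obj X))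
    (hl : ∀ X, PU X → PT (R.l.functor.obj X)) (hr : ∀ X, PU X → PT (R.r.functor.obj X))
    (R' : TriangulatedRecollement PS.FullSubcategory PT.FullSubcategory PU.FullSubcategory),
    R'.i = R.i.restrict PS PT hi ∧ R'.q = R.q.restrict PT PS hq ∧ R'.p = R.p.restrict PT PS hp ∧
    R'.e = R.e.restrict PT PU he ∧ R'.l = R.l.restrict PU PT hl ∧ R'.r = R.r.restrict PU PT hr

/-- The recollement `R' = (U, T, S)` continues the recollement `R = (S, T, U)` one step downwards:
the functors of `R` and `R'` form a ladder

`S ← T`, `T ← U` (the functors `q` and `l` of `R`),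
`S → T`, `T → U` (the functors `i` and `e` of `R`, the functors `l` and `q` of `R'`),
`S ← T`, `T ← U` (the functors `p` and `r` of `R`, the functors `e` and `i` of `R'`),
`S → T`, `T → U` (the functors `r` and `p` of `R'`),

in which any two consecutive rows consist of adjoint pairs and any three consecutive rows form a
recollement, i.e. a ladder of height two. -/
def IsContinuedDownwardsBy (R : TriangulatedRecollement S T U)
    (R' : TriangulatedRecollement U T S) : Prop :=
  R'.q = R.e ∧ R'.i = R.r ∧ R'.l = R.i ∧ R'.e = R.p

end TriangulatedRecollement

end Triangulated

/-! ## Recollements of abelian categories and ladders -/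

section Abelian

variable (A : Type u₁) [Category.{v₁} A] [Abelian A] (B : Type u₂) [Category.{v₂} B] [Abelian B]
  (C : Type u₃) [Category.{v₃} C] [Abelian C]

/-- A recollement of abelian categories. (All the functors are additive, since they are
left or right adjoints.) -/
structure AbelianRecollement where
  /-- the functor `A ⥤ B` -/
  i : A ⥤ B
  /-- the left adjoint of `i` -/
  q : B ⥤ A
  /-- the right adjoint of `i` -/
  p : B ⥤ A
  /-- the functor `B ⥤ C` -/
  e : B ⥤ C
  /-- the left adjoint of `e` -/
  l : C ⥤ B
  /-- the right adjoint of `e` -/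
  r : C ⥤ B
  /-- the adjunction `(q, i)` -/
  adj_q_i : q ⊣ i
  /-- the adjunction `(i, p)` -/
  adj_i_p : i ⊣ p
  /-- the adjunction `(l, e)` -/
  adj_l_e : l ⊣ e
  /-- the adjunction `(e, r)` -/
  adj_e_r : e ⊣ r
  i_full : i.Full
  i_faithful : i.Faithful
  l_full : l.Full
  l_faithful : l.Faithful
  r_full : r.Full
  r_faithful : r.Faithful
  essImage_i_iff : ∀ X : B, i.essImage X ↔ IsZero (e.obj X)

variable {A B C}

/-- A ladder of `l`-height three: functors `l²`, `l¹` such that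
`(l², l¹)` and `(l¹, l⁰)` are adjoint pairs, where `l⁰ = l`. -/
structure LeftLadderThree (R : AbelianRecollement A B C) where
  /-- the functor `l¹` -/
  l₁ : B ⥤ C
  /-- the functor `l²` -/
  l₂ : C ⥤ B
  /-- the adjunction `(l¹, l⁰)` -/
  adj₁ : l₁ ⊣ R.l
  /-- the adjunction `(l², l¹)` -/
  adj₂ : l₂ ⊣ l₁

/-- A ladder of `l`-height four. -/
structure LeftLadderFour (R : AbelianRecollement A B C) extends LeftLadderThree R where
  /-- the functor `l³` -/
  l₃ : B ⥤ C
  /-- the adjunction `(l³, l²)` -/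
  adj₃ : l₃ ⊣ l₂

/-- A ladder of `r`-height two: a functor `r¹` such that `(r⁰, r¹)` is an adjoint pair,
where `r⁰ = r`. -/
structure RightLadderTwo (R : AbelianRecollement A B C) where
  /-- the functor `r¹` -/
  r₁ : B ⥤ C
  /-- the adjunction `(r⁰, r¹)` -/
  adj₁ : R.r ⊣ r₁

/-- A ladder of `r`-height three. -/
structure RightLadderThree (R : AbelianRecollement A B C) extends RightLadderTwo R where
  /-- the functor `r²` -/
  r₂ : C ⥤ B
  /-- the adjunction `(r¹, r²)` -/
  adj₂ : r₁ ⊣ r₂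

/-- A functor between abelian categories is exact if it preserves finite limits and
finite colimits. -/
structure IsExact (F : B ⥤ C) : Prop where
  preservesFiniteLimits : PreservesFiniteLimits F
  preservesFiniteColimits : PreservesFiniteColimits F

namespace IsExact

variable {F : B ⥤ C}

lemma additive (hF : IsExact F) : F.Additive := by
  have := hF.preservesFiniteLimits
  exact Functor.additive_of_preserves_binary_products F

/-- A functor which has a left adjoint and a right adjoint is exact. -/
lemma of_adj {L R : C ⥤ B} (adj₁ : L ⊣ F) (adj₂ : F ⊣ R) : IsExact F where
  preservesFiniteLimits := ⟨fun _ _ _ => (adj₁.rightAdjoint_preservesLimits).preservesLimitsOfShape⟩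
  preservesFiniteColimits :=
    ⟨fun _ _ _ => (adj₂.leftAdjoint_preservesColimits).preservesColimitsOfShape⟩

/-- The left adjoint of an exact functor preserves projective objects. -/
lemma preservesProjectiveObjects {G : C ⥤ B} (hG : IsExact G) (adj : F ⊣ G) :
    F.PreservesProjectiveObjects :=
  have := hG.preservesFiniteColimits
  Functor.preservesProjectiveObjects_of_adjunction_of_preservesEpimorphisms adj

end IsExact

section

variable {R : AbelianRecollement A B C}

lemma AbelianRecollement.exact_e (R : AbelianRecollement A B C) : IsExact R.e :=
  .of_adj R.adj_l_e R.adj_e_r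

lemma LeftLadderThree.exact_l (L : LeftLadderThree R) : IsExact R.l :=
  .of_adj L.adj₁ R.adj_l_e

lemma LeftLadderThree.exact_l₁ (L : LeftLadderThree R) : IsExact L.l₁ :=
  .of_adj L.adj₂ L.adj₁

lemma LeftLadderThree.proj_l (_ : LeftLadderThree R) : R.l.PreservesProjectiveObjects :=
  R.exact_e.preservesProjectiveObjects R.adj_l_e

lemma LeftLadderThree.proj_l₁ (L : LeftLadderThree R) : L.l₁.PreservesProjectiveObjects :=
  L.exact_l.preservesProjectiveObjects L.adj₁

lemma LeftLadderFour.exact_l₂ (L : LeftLadderFour R) : IsExact L.l₂ :=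
  .of_adj L.adj₃ L.adj₂

lemma LeftLadderFour.proj_l₂ (L : LeftLadderFour R) : L.l₂.PreservesProjectiveObjects :=
  L.exact_l₁.preservesProjectiveObjects L.adj₂

lemma RightLadderTwo.exact_r (M : RightLadderTwo R) : IsExact R.r :=
  .of_adj R.adj_e_r M.adj₁

lemma RightLadderTwo.proj_e (M : RightLadderTwo R) : R.e.PreservesProjectiveObjects :=
  M.exact_r.preservesProjectiveObjects R.adj_e_r

end

end Abelian

/-! ## Derived categories and singularity categories -/

section Derived

variable {A : Type u₁} [Category.{v₁} A] [Abelian A]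
  {B : Type u₂} [Category.{v₂} B] [Abelian B] [HasDerivedCategory.{w₁} B]
  {C : Type u₃} [Category.{v₃} C] [Abelian C] [HasDerivedCategory.{w₂} C]

/-- The triangle functor `D(B) ⥤ D(C)` induced by an exact functor. -/
def derivedFunctor (F : B ⥤ C) (hF : IsExact F) :
    TriangleFunctor (DerivedCategory B) (DerivedCategory C) :=
  have := hF.additive
  have := hF.preservesFiniteLimits
  have := hF.preservesFiniteColimits
  { functor := F.mapDerivedCategory
    commShift := inferInstance
    isTriangulated := inferInstance }

variable (B) in
/-- The complexes with bounded cohomology, as a full subcategory of `D(B)`. -/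
abbrev bounded : ObjectProperty (DerivedCategory B) := DerivedCategory.TStructure.t.bounded

variable (B) in
/-- The bounded derived category `Dᵇ(B)`. -/
abbrev BoundedDerivedCategory := (bounded B).FullSubcategory

/-- The full subcategory `D_A(B)` of `D(B)`, which consists of the complexes with
cohomologies in the essential image of `i : A ⥤ B`. -/
def cohomologyIn (R : AbelianRecollement A B C) : ObjectProperty (DerivedCategory B) :=
  fun X => ∀ n : ℤ, R.i.essImage ((DerivedCategory.homologyFunctor B n).obj X)

instance (R : AbelianRecollement A B C) :
    (cohomologyIn R).IsClosedUnderIsomorphisms where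
  of_iso e hX n := R.i.essImage.prop_of_iso ((DerivedCategory.homologyFunctor B n).mapIso e) (hX n)

instance (R : AbelianRecollement A B C) : (cohomologyIn R).IsTriangulated := by
  have := R.exact_e.additive
  have := R.exact_e.preservesFiniteLimits
  have := R.exact_e.preservesFiniteColimits
  have : (DerivedCategory.homologyFunctor B 0 ⋙ R.e).IsHomological :=
    { exact := fun T hT =>
        ((DerivedCategory.homologyFunctor B 0).map_distinguished_exact T hT).map R.e }
  have h : cohomologyIn R = (DerivedCategory.homologyFunctor B 0 ⋙ R.e).homologicalKernel := by
    ext X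
    refine forall_congr' fun n => (R.essImage_i_iff _).trans ?_
    exact (R.e.mapIso (((DerivedCategory.homologyFunctor B 0).isoShift n).app X)).isZero_iff.symm
  rw [h]
  infer_instance

variable (B) in
/-- The objects of `D(B)` which are isomorphic to bounded complexes of projective objects, i.e.
the essential image of `Kᵇ(Proj B)`. -/
def perfectComplexes : ObjectProperty (DerivedCategory B) := fun X =>
  ∃ (K : CochainComplex B ℤ) (a b : ℤ), K.IsStrictlyGE a ∧ K.IsStrictlyLE b ∧
    (∀ n, Projective (K.X n)) ∧ Nonempty (X ≅ DerivedCategory.Q.obj K)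

instance : (perfectComplexes B).IsClosedUnderIsomorphisms where
  of_iso := by
    rintro X Y e ⟨K, a, b, h₁, h₂, h₃, ⟨e'⟩⟩
    exact ⟨K, a, b, h₁, h₂, h₃, ⟨e.symm ≪≫ e'⟩⟩

instance : (perfectComplexes B).IsStableUnderShift ℤ where
  isStableUnderShiftBy n :=
    { le_shift := by
        rintro X ⟨K, a, b, _, _, h, ⟨e⟩⟩
        exact ⟨K⟦n⟧, a - n, b - n, K.isStrictlyGE_shift a n _ (by lia),
          K.isStrictlyLE_shift b n _ (by lia), fun i => h (i + n),
          ⟨(shiftFunctor _ n).mapIso e ≪≫ (DerivedCategory.Q.commShiftIso n).symm.app K⟩⟩ }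

lemma exists_Q_map_eq (K L : CochainComplex B ℤ) [K.IsKProjective]
    (f : DerivedCategory.Q.obj K ⟶ DerivedCategory.Q.obj L) :
    ∃ g : K ⟶ L, DerivedCategory.Q.map g = f := by
  let e := DerivedCategory.quotientCompQhIso B
  obtain ⟨h, hh⟩ := (CochainComplex.IsKProjective.Qh_map_bijective K
    ((HomotopyCategory.quotient _ _).obj L)).surjective (e.hom.app K ≫ f ≫ e.inv.app L)
  obtain ⟨g, rfl⟩ := (HomotopyCategory.quotient B (.up ℤ)).map_surjective h
  refine ⟨g, ?_⟩
  have hg := e.hom.naturality g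
  rw [← cancel_epi (e.hom.app K), ← hg, Functor.comp_map, hh]
  simp

instance : (perfectComplexes B).IsTriangulatedClosed₃ := .mk' (by
  rintro T hT ⟨K, a, b, _, _, hK, ⟨e₁⟩⟩ ⟨L, c, d, _, _, hL, ⟨e₂⟩⟩
  have := CochainComplex.isKProjective_of_projective K b
  obtain ⟨g, hg⟩ := exists_Q_map_eq K L (e₁.inv ≫ T.mor₁ ≫ e₂.hom)
  refine ⟨CochainComplex.mappingCone g, min (a - 1) c, max b d, ?_, ?_, fun n => ?_, ⟨?_⟩⟩
  · exact CochainComplex.isStrictlyGE_mappingCone g a c _ (by lia) (by lia)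
  · rw [CochainComplex.isStrictlyLE_iff]
    intro i hi
    rw [CochainComplex.mappingCone.isZero_X_iff]
    exact ⟨K.isZero_of_isStrictlyLE b _ (by lia), L.isZero_of_isStrictlyLE d _ (by lia)⟩
  · exact Projective.of_iso (HomologicalComplex.homotopyCofiber.XIsoBiprod g n (n + 1) rfl).symm
      inferInstance
  · exact Pretriangulated.Triangle.π₃.mapIso (Pretriangulated.isoTriangleOfIso₁₂ T _ hT
      (DerivedCategory.mappingCone_triangle_distinguished g) e₁ e₂ (by
        change T.mor₁ ≫ e₂.hom = e₁.hom ≫ DerivedCategory.Q.map g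
        rw [hg]; simp)))

instance : (perfectComplexes B).IsTriangulated where
  exists_zero := ⟨0, isZero_zero _, 0, 0, 0, inferInstance, inferInstance,
    fun n => ((HomologicalComplex.eval B (.up ℤ) n).map_isZero (isZero_zero _)).projective,
    ⟨(isZero_zero _).iso (DerivedCategory.Q.map_isZero (isZero_zero _))⟩⟩
  toIsTriangulatedClosed₂ := .of_isTriangulatedClosed₃

variable (B) in
/-- The essential image of `Kᵇ(Proj B)` in `Dᵇ(B)`. -/
abbrev perfect : ObjectProperty (BoundedDerivedCategory B) :=
  (perfectComplexes B).inverseImage (bounded B).ι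

variable (B) in
/-- The singularity category `D_sg(B) = Dᵇ(B) / Kᵇ(Proj B)`. -/
abbrev SingularityCategory := VerdierQuotient (perfect B)

lemma isStrictlyGE_map (F : B ⥤ C) [F.Additive] (K : CochainComplex B ℤ) (n : ℤ)
    [K.IsStrictlyGE n] :
    CochainComplex.IsStrictlyGE ((F.mapHomologicalComplex (.up ℤ)).obj K) n := by
  rw [CochainComplex.isStrictlyGE_iff]
  exact fun i hi => F.map_isZero (K.isZero_of_isStrictlyGE n i hi)

lemma isStrictlyLE_map (F : B ⥤ C) [F.Additive] (K : CochainComplex B ℤ) (n : ℤ)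
    [K.IsStrictlyLE n] :
    CochainComplex.IsStrictlyLE ((F.mapHomologicalComplex (.up ℤ)).obj K) n := by
  rw [CochainComplex.isStrictlyLE_iff]
  exact fun i hi => F.map_isZero (K.isZero_of_isStrictlyLE n i hi)

lemma bounded_derivedFunctor (F : B ⥤ C) (hF : IsExact F) (X : DerivedCategory B)
    (hX : bounded B X) : bounded C ((derivedFunctor F hF).functor.obj X) := by
  have := hF.additive
  have := hF.preservesFiniteLimits
  have := hF.preservesFiniteColimits
  obtain ⟨⟨a, ⟨K, e, _⟩⟩, ⟨b, ⟨L, e', _⟩⟩⟩ := hX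
  exact ⟨⟨a, ⟨_, F.mapDerivedCategory.mapIso e ≪≫ F.mapDerivedCategoryFactors.app K,
      isStrictlyGE_map F K a⟩⟩,
    ⟨b, ⟨_, F.mapDerivedCategory.mapIso e' ≪≫ F.mapDerivedCategoryFactors.app L,
      isStrictlyLE_map F L b⟩⟩⟩

/-- The triangle functor `Dᵇ(B) ⥤ Dᵇ(C)` induced by an exact functor. -/
def boundedDerivedFunctor (F : B ⥤ C) (hF : IsExact F) :
    TriangleFunctor (BoundedDerivedCategory B) (BoundedDerivedCategory C) :=
  (derivedFunctor F hF).restrict _ _ (bounded_derivedFunctor F hF)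

lemma perfect_boundedDerivedFunctor (F : B ⥤ C) (hF : IsExact F)
    (hF' : F.PreservesProjectiveObjects) (X : BoundedDerivedCategory B)
    (hX : perfect B X) : perfect C ((boundedDerivedFunctor F hF).functor.obj X) := by
  have := hF.additive
  have := hF.preservesFiniteLimits
  have := hF.preservesFiniteColimits
  obtain ⟨K, a, b, _, _, h, ⟨e⟩⟩ := hX
  exact ⟨(F.mapHomologicalComplex _).obj K, a, b, isStrictlyGE_map F K a, isStrictlyLE_map F K b,
    fun n => F.projective_obj_of_projective (h n),
    ⟨F.mapDerivedCategory.mapIso e ≪≫ F.mapDerivedCategoryFactors.app K⟩⟩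

/-- The triangle functor `D_sg(B) ⥤ D_sg(C)` induced by an exact functor which preserves
projective objects. -/
def singularityFunctor (F : B ⥤ C) (hF : IsExact F) (hF' : F.PreservesProjectiveObjects) :
    TriangleFunctor (SingularityCategory B) (SingularityCategory C) :=
  (boundedDerivedFunctor F hF).onQuotients _ _ (perfect_boundedDerivedFunctor F hF hF')

end Derived

end LadderRecollement

end

open LadderRecollement

/-! Everything is formal once the adjunctions of the ladder are lifted. A functor with adjoints on
both sides is exact, and a left adjoint of an exact functor preserves projectives. An adjunction
between exact functors acts degreewise on complexes, descends to `D`, restricts to `Dᵇ`, and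
descends to `D_sg` when both functors preserve projectives. The lifted counit is computed from the
original one, so an invertible counit stays invertible: full faithfulness of `l` and `r` is
inherited at every level.

Two facts about triangulated categories then suffice. A triangle functor with a fully faithful right
adjoint is a localization at the maps it inverts, that is, at the maps whose cone lies in its
kernel; this gives both Verdier equivalences
(`TriangleFunctor.inducesVerdierEquivalence_of_adjunction`). Given `q ⊣ i ⊣ p` with `i` fully
faithful, the triangles `i p X ⟶ X ⟶ κ X` and `φ X ⟶ X ⟶ i q X` define a reflection `κ` onto `Ker p`
and a coreflection `φ` onto `Ker q`. They restrict to an equivalence between the two kernels, which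
supplies the remaining adjoint and a recollement with either kernel as third term (`ofKernelRight`,
`ofKernelLeft`).

For `(l¹, l, e)` on `D`, the kernel of `e` is `D_A(B)` because `e` is exact; the triangles show that
boundedness is preserved. On `D_sg` the same triple gives the recollement with `Ker l¹`, while `(l²,
l¹, l)` gives the one with `Ker l¹` as first term (`ofKernelMiddle`). -/

namespace LadderRecollement

/-! ### Bousfield (co)localization: kernels of the adjoints of a fully faithful triangle functor. -/

section Bousfield

variable {S : Type u₁} [Category.{v₁} S] [HasZeroObject S] [HasShift S ℤ] [Preadditive S]
  [∀ n : ℤ, (shiftFunctor S n).Additive] [Pretriangulated S]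
  {T : Type u₂} [Category.{v₂} T] [HasZeroObject T] [HasShift T ℤ] [Preadditive T]
  [∀ n : ℤ, (shiftFunctor T n).Additive] [Pretriangulated T]

namespace TriangleFunctor

/-- A left adjoint of a triangle functor, as a triangle functor. -/
noncomputable def ofLeftAdjoint (G : TriangleFunctor S T) (F : T ⥤ S) (adj : F ⊣ G.functor) :
    TriangleFunctor T S :=
  letI : F.CommShift ℤ := adj.leftAdjointCommShift ℤ
  haveI : adj.CommShift ℤ := adj.commShift_of_rightAdjoint ℤ
  { functor := F
    commShift := inferInstance
    isTriangulated := adj.isTriangulated_leftAdjoint }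

/-- A right adjoint of a triangle functor, as a triangle functor. -/
noncomputable def ofRightAdjoint (F : TriangleFunctor S T) (G : T ⥤ S) (adj : F.functor ⊣ G) :
    TriangleFunctor T S :=
  letI : G.CommShift ℤ := adj.rightAdjointCommShift ℤ
  haveI : adj.CommShift ℤ := adj.commShift_of_leftAdjoint ℤ
  { functor := G
    commShift := inferInstance
    isTriangulated := adj.isTriangulated_rightAdjoint }

lemma isIso_map_mor₁_iff (F : TriangleFunctor S T) (t : Pretriangulated.Triangle S)
    (ht : t ∈ distTriang S) : IsIso (F.functor.map t.mor₁) ↔ IsZero (F.functor.obj t.obj₃) :=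
  (Pretriangulated.Triangle.isZero₃_iff_isIso₁ _ (F.functor.map_distinguished _ ht)).symm

lemma isIso_map_mor₂_iff (F : TriangleFunctor S T) (t : Pretriangulated.Triangle S)
    (ht : t ∈ distTriang S) : IsIso (F.functor.map t.mor₂) ↔ IsZero (F.functor.obj t.obj₁) :=
  (Pretriangulated.Triangle.isZero₁_iff_isIso₂ _ (F.functor.map_distinguished _ ht)).symm

/-- The cone of `f` is sent to the cone of its image, which vanishes exactly when that image is
invertible. -/
lemma kernel_trW_iff (F : TriangleFunctor S T) {X Y : S} (f : X ⟶ Y) :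
    F.kernel.trW f ↔ IsIso (F.functor.map f) := by
  obtain ⟨Z, g, h, hT⟩ := Pretriangulated.distinguished_cocone_triangle f
  exact (F.kernel.trW_iff_of_distinguished _ hT).trans (F.isIso_map_mor₁_iff _ hT).symm

end TriangleFunctor

variable {i : TriangleFunctor S T} {q p : TriangleFunctor T S}

/-- Orthogonality of the image of a left adjoint and the kernel of its right adjoint. The hom set is
in bijection with a one-element set, so additivity of the functors plays no role. -/
lemma eq_zero_of_isZero_rightAdjoint {C : Type u₁} [Category.{v₁} C] [Preadditive C]
    {D : Type u₂} [Category.{v₂} D] [Preadditive D] {F : C ⥤ D} {G : D ⥤ C} (adj : F ⊣ G)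
    {X : C} {Y : D} (hY : IsZero (G.obj Y)) (f : F.obj X ⟶ Y) : f = 0 :=
  (adj.homEquiv _ _).injective (hY.eq_of_tgt _ _)

lemma eq_zero_of_isZero_leftAdjoint {C : Type u₁} [Category.{v₁} C] [Preadditive C]
    {D : Type u₂} [Category.{v₂} D] [Preadditive D] {F : C ⥤ D} {G : D ⥤ C} (adj : F ⊣ G)
    {X : C} {Y : D} (hX : IsZero (F.obj X)) (f : X ⟶ G.obj Y) : f = 0 :=
  (adj.homEquiv _ _).symm.injective (hX.eq_of_src _ _)

/-- Full faithfulness of `i` makes `p` invert the counit, so `p` kills its cone. This cone will be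
the reflection of `X` onto `Ker p`. -/
lemma exists_triangle_of_rightAdjoint [i.functor.Full] [i.functor.Faithful]
    (adj : i.functor ⊣ p.functor) (X : T) :
    ∃ (Z : T) (g : X ⟶ Z) (h : Z ⟶ (i.functor.obj (p.functor.obj X))⟦(1 : ℤ)⟧),
      Pretriangulated.Triangle.mk (adj.counit.app X) g h ∈ distTriang T ∧
        IsZero (p.functor.obj Z) := by
  obtain ⟨Z, g, h, hT⟩ := Pretriangulated.distinguished_cocone_triangle (adj.counit.app X)
  refine ⟨Z, g, h, hT, (p.isIso_map_mor₁_iff _ hT).1 ?_⟩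
  change IsIso (p.functor.map (adj.counit.app X))
  infer_instance

lemma exists_triangle_of_leftAdjoint [i.functor.Full] [i.functor.Faithful]
    (adj : q.functor ⊣ i.functor) (X : T) :
    ∃ (Z : T) (g : Z ⟶ X) (h : i.functor.obj (q.functor.obj X) ⟶ Z⟦(1 : ℤ)⟧),
      Pretriangulated.Triangle.mk g (adj.unit.app X) h ∈ distTriang T ∧
        IsZero (q.functor.obj Z) := by
  obtain ⟨Z, g, h, hT⟩ := Pretriangulated.distinguished_cocone_triangle₁ (adj.unit.app X)
  refine ⟨Z, g, h, hT, (q.isIso_map_mor₂_iff _ hT).1 ?_⟩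
  change IsIso (q.functor.map (adj.unit.app X))
  infer_instance

/-- If `i` is fully faithful with right adjoint `p`, the inclusion of the kernel of `p` has a
left adjoint. -/
theorem exists_leftAdjoint_inclusion [i.functor.Full] [i.functor.Faithful]
    (adj : i.functor ⊣ p.functor) (P : ObjectProperty T) [P.IsTriangulated]
    (hP : ∀ X, P X ↔ IsZero (p.functor.obj X)) :
    ∃ κ : TriangleFunctor T P.FullSubcategory,
      Nonempty (κ.functor ⊣ (TriangleFunctor.inclusion P).functor) := by
  choose Z g h hT hZ using exists_triangle_of_rightAdjoint adj
  -- Uniqueness of factorizations through `g X`: a map killed by `g X` factors through the shift of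
  -- `i p X`. That shift is isomorphic to an object in the image of `i`, hence orthogonal to `P`.
  have hinj (X : T) {Y : T} (a : Z X ⟶ Y) (hY : P Y) (ha : g X ≫ a = 0) : a = 0 := by
    obtain ⟨c, hc⟩ : ∃ c : (i.functor.obj (p.functor.obj X))⟦(1 : ℤ)⟧ ⟶ Y, a = h X ≫ c :=
      Pretriangulated.Triangle.yoneda_exact₃ _ (hT X) a ha
    have hc₀ : (i.functor.commShiftIso (1 : ℤ)).hom.app (p.functor.obj X) ≫ c = 0 :=
      eq_zero_of_isZero_rightAdjoint adj ((hP _).1 hY) _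
    rw [hc, (cancel_epi ((i.functor.commShiftIso (1 : ℤ)).hom.app (p.functor.obj X))).1
      (hc₀.trans comp_zero.symm), comp_zero]
  let e (X : T) (Y : P.FullSubcategory) :
      ((⟨Z X, (hP _).2 (hZ X)⟩ : P.FullSubcategory) ⟶ Y) ≃ (X ⟶ P.ι.obj Y) :=
    Equiv.ofBijective (fun a => g X ≫ a.hom) (by
      refine ⟨fun a b hab => ?_, fun a => ?_⟩
      · ext
        rw [← sub_eq_zero]
        refine hinj X (a.hom - b.hom) Y.property ?_
        rw [Preadditive.comp_sub, sub_eq_zero]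
        exact hab
      · obtain ⟨c, hc⟩ := Pretriangulated.Triangle.yoneda_exact₂ _ (hT X) a
          (eq_zero_of_isZero_rightAdjoint adj ((hP _).1 Y.property) _)
        exact ⟨ObjectProperty.homMk c, hc.symm⟩)
  have he : ∀ X Y Y' k a, e X Y' (a ≫ k) = e X Y a ≫ P.ι.map k :=
    fun X Y Y' k a => (Category.assoc _ _ _).symm
  exact ⟨(TriangleFunctor.inclusion P).ofLeftAdjoint _ (Adjunction.adjunctionOfEquivLeft e he),
    ⟨Adjunction.adjunctionOfEquivLeft e he⟩⟩

/-- If `i` is fully faithful with left adjoint `q`, the inclusion of the kernel of `q` has a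
right adjoint. -/
theorem exists_rightAdjoint_inclusion [i.functor.Full] [i.functor.Faithful]
    (adj : q.functor ⊣ i.functor) (P : ObjectProperty T) [P.IsTriangulated]
    (hP : ∀ X, P X ↔ IsZero (q.functor.obj X)) :
    ∃ φ : TriangleFunctor T P.FullSubcategory,
      Nonempty ((TriangleFunctor.inclusion P).functor ⊣ φ.functor) := by
  choose Z g h hT hZ using exists_triangle_of_leftAdjoint adj
  -- The exactness statement used here concerns maps into the shifted first term, so `a` is shifted
  -- first; `q` commutes with the shift and therefore kills `Y⟦1⟧`.
  have hinj (X : T) {Y : T} (a : Y ⟶ Z X) (hY : P Y) (ha : a ≫ g X = 0) : a = 0 := by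
    obtain ⟨c, hc⟩ : ∃ c : Y⟦(1 : ℤ)⟧ ⟶ i.functor.obj (q.functor.obj X), a⟦(1 : ℤ)⟧' = c ≫ h X :=
      Pretriangulated.Triangle.coyoneda_exact₁ _ (hT X) (a⟦(1 : ℤ)⟧')
        (((shiftFunctor T (1 : ℤ)).map_comp a (g X)).symm.trans (congrArg _ ha |>.trans (Functor.map_zero _ _ _)))
    have hc₀ : c = 0 := eq_zero_of_isZero_leftAdjoint adj
      (((shiftFunctor S (1 : ℤ)).map_isZero ((hP _).1 hY)).of_iso
        ((q.functor.commShiftIso (1 : ℤ)).app _)) c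
    apply (shiftFunctor T (1 : ℤ)).map_injective
    rw [hc, hc₀, zero_comp, Functor.map_zero]
  let e (Y : P.FullSubcategory) (X : T) :
      (P.ι.obj Y ⟶ X) ≃ (Y ⟶ (⟨Z X, (hP _).2 (hZ X)⟩ : P.FullSubcategory)) :=
    (Equiv.ofBijective (fun a => a.hom ≫ g X) (by
      refine ⟨fun a b hab => ?_, fun a => ?_⟩
      · ext
        rw [← sub_eq_zero]
        refine hinj X (a.hom - b.hom) Y.property ?_
        rw [Preadditive.sub_comp, sub_eq_zero]
        exact hab
      · obtain ⟨c, hc⟩ := Pretriangulated.Triangle.coyoneda_exact₂ _ (hT X) a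
          (eq_zero_of_isZero_leftAdjoint adj ((hP _).1 Y.property) _)
        exact ⟨ObjectProperty.homMk c, hc.symm⟩)).symm
  have he : ∀ Y' Y X k a, e Y' X (P.ι.map k ≫ a) = k ≫ e Y X a := fun Y' Y X k a => by
    rw [← Equiv.eq_symm_apply]
    change _ = (k ≫ e Y X a).hom ≫ g X
    obtain ⟨b, rfl⟩ := (e Y X).symm.surjective a
    rw [Equiv.apply_symm_apply]
    exact (Category.assoc _ _ _).symm
  exact ⟨(TriangleFunctor.inclusion P).ofRightAdjoint _ (Adjunction.adjunctionOfEquivRight e he),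
    ⟨Adjunction.adjunctionOfEquivRight e he⟩⟩

section

variable {P Q : ObjectProperty T} [P.IsTriangulated] [Q.IsTriangulated]
  {κ : TriangleFunctor T P.FullSubcategory} {φ : TriangleFunctor T Q.FullSubcategory}

/-- The identity of `κ (i X)` corresponds to a map from `i X` to an object of `Ker p`, which is zero
by orthogonality. -/
lemma isZero_leftAdjoint_inclusion_obj (adj : i.functor ⊣ p.functor)
    (hP : ∀ X, P X ↔ IsZero (p.functor.obj X))
    (adjκ : κ.functor ⊣ (TriangleFunctor.inclusion P).functor) (X : S) :
    IsZero (κ.functor.obj (i.functor.obj X)) := by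
  rw [IsZero.iff_id_eq_zero]
  apply (adjκ.homEquiv _ _).injective
  rw [eq_zero_of_isZero_rightAdjoint adj
    ((hP _).1 (κ.functor.obj (i.functor.obj X)).property) (adjκ.homEquiv _ _ (𝟙 _))]
  exact (eq_zero_of_isZero_rightAdjoint adj
    ((hP _).1 (κ.functor.obj (i.functor.obj X)).property) (adjκ.homEquiv _ _ 0)).symm

lemma isZero_rightAdjoint_inclusion_obj (adj : q.functor ⊣ i.functor)
    (hQ : ∀ X, Q X ↔ IsZero (q.functor.obj X))
    (adjφ : (TriangleFunctor.inclusion Q).functor ⊣ φ.functor) (X : S) :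
    IsZero (φ.functor.obj (i.functor.obj X)) := by
  rw [IsZero.iff_id_eq_zero]
  apply (adjφ.homEquiv _ _).symm.injective
  rw [eq_zero_of_isZero_leftAdjoint adj
    ((hQ _).1 (φ.functor.obj (i.functor.obj X)).property) ((adjφ.homEquiv _ _).symm (𝟙 _))]
  exact (eq_zero_of_isZero_leftAdjoint adj
    ((hQ _).1 (φ.functor.obj (i.functor.obj X)).property) ((adjφ.homEquiv _ _).symm 0)).symm

/-- The localization triangle `i p X ⟶ X ⟶ κ X`. -/
lemma leftAdjoint_inclusion_triangle [i.functor.Full] [i.functor.Faithful]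
    (adj : i.functor ⊣ p.functor)
    (hP : ∀ X, P X ↔ IsZero (p.functor.obj X))
    (adjκ : κ.functor ⊣ (TriangleFunctor.inclusion P).functor) (X : T) :
    ∃ (f : i.functor.obj (p.functor.obj X) ⟶ X) (h : _),
      Pretriangulated.Triangle.mk f (adjκ.unit.app X) h ∈ distTriang T := by
  -- The reflection `κ` is arbitrary, so its unit has to be compared with the cone of the counit:
  -- `κ` kills `i p X`, hence inverts `g`, and the unit at `Z` is invertible since `Z` lies in `P`.
  -- Thus `Z` is `κ X`, compatibly with the maps from `X`.
  obtain ⟨Z, g, h, hT, hZ⟩ := exists_triangle_of_rightAdjoint adj X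
  have hι : (TriangleFunctor.inclusion P).functor.FullyFaithful := P.fullyFaithfulι
  have := hι.full
  have := hι.faithful
  have h₁ : IsIso (κ.functor.map g) := (κ.isIso_map_mor₂_iff _ hT).2
    (isZero_leftAdjoint_inclusion_obj adj hP adjκ _)
  let Z' : P.FullSubcategory := ⟨Z, (hP _).2 hZ⟩
  have h₂ : IsIso (adjκ.unit.app Z) :=
    inferInstanceAs (IsIso (adjκ.unit.app ((TriangleFunctor.inclusion P).functor.obj Z')))
  let e := (TriangleFunctor.inclusion P).functor.mapIso (asIso (κ.functor.map g))
  have hg : g ≫ adjκ.unit.app Z = adjκ.unit.app X ≫ e.hom := adjκ.unit.naturality g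
  refine ⟨adj.counit.app X, (e ≪≫ (asIso (adjκ.unit.app Z)).symm).hom ≫ h,
    Pretriangulated.isomorphic_distinguished _ hT _ ?_⟩
  refine Pretriangulated.Triangle.isoMk _ _ (Iso.refl _) (Iso.refl _)
    (e ≪≫ (asIso (adjκ.unit.app Z)).symm) ?_ ?_ ?_
  · exact (Category.comp_id _).trans (Category.id_comp _).symm
  · change adjκ.unit.app X ≫ e.hom ≫ inv (adjκ.unit.app Z) = 𝟙 _ ≫ g
    rw [← reassoc_of% hg]
    simp
  · exact (congrArg (_ ≫ ·) ((shiftFunctor T (1 : ℤ)).map_id _)).trans (Category.comp_id _)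

/-- The colocalization triangle `φ X ⟶ X ⟶ i q X`. -/
lemma rightAdjoint_inclusion_triangle [i.functor.Full] [i.functor.Faithful]
    (adj : q.functor ⊣ i.functor)
    (hQ : ∀ X, Q X ↔ IsZero (q.functor.obj X))
    (adjφ : (TriangleFunctor.inclusion Q).functor ⊣ φ.functor) (X : T) :
    ∃ (f : X ⟶ i.functor.obj (q.functor.obj X)) (h : _),
      Pretriangulated.Triangle.mk (adjφ.counit.app X) f h ∈ distTriang T := by
  obtain ⟨Z, g, h, hT, hZ⟩ := exists_triangle_of_leftAdjoint adj X
  have hι : (TriangleFunctor.inclusion Q).functor.FullyFaithful := Q.fullyFaithfulι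
  have := hι.full
  have := hι.faithful
  have h₁ : IsIso (φ.functor.map g) := (φ.isIso_map_mor₁_iff _ hT).2
    (isZero_rightAdjoint_inclusion_obj adj hQ adjφ _)
  let Z' : Q.FullSubcategory := ⟨Z, (hQ _).2 hZ⟩
  have h₂ : IsIso (adjφ.counit.app Z) :=
    inferInstanceAs (IsIso (adjφ.counit.app ((TriangleFunctor.inclusion Q).functor.obj Z')))
  let e := (TriangleFunctor.inclusion Q).functor.mapIso (asIso (φ.functor.map g))
  have hg : e.hom ≫ adjφ.counit.app X = adjφ.counit.app Z ≫ g := adjφ.counit.naturality g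
  let e' := e.symm ≪≫ asIso (adjφ.counit.app Z)
  have he' : e'.hom ≫ g = adjφ.counit.app X := by
    change (e.inv ≫ adjφ.counit.app Z) ≫ g = _
    rw [Category.assoc, ← hg, Iso.inv_hom_id_assoc]
  refine ⟨adj.unit.app X, h ≫ e'.inv⟦1⟧',
    Pretriangulated.isomorphic_distinguished _ hT _ ?_⟩
  refine Pretriangulated.Triangle.isoMk _ _ e' (Iso.refl _) (Iso.refl _) ?_ ?_ ?_
  · exact (Category.comp_id _).trans he'.symm
  · exact (Category.comp_id _).trans (Category.id_comp _).symm
  · change (h ≫ e'.inv⟦1⟧') ≫ e'.hom⟦1⟧' = 𝟙 _ ≫ h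
    rw [Category.assoc, ← Functor.map_comp, e'.inv_hom_id, Category.id_comp]
    exact (congrArg (h ≫ ·) ((shiftFunctor T (1 : ℤ)).map_id _)).trans (Category.comp_id _)

end

end Bousfield

/-! ### Recollements built from an adjoint triple and a kernel. -/

section Bousfield

variable {S : Type u₁} [Category.{v₁} S] [HasZeroObject S] [HasShift S ℤ] [Preadditive S]
  [∀ n : ℤ, (shiftFunctor S n).Additive] [Pretriangulated S]
  {T : Type u₂} [Category.{v₂} T] [HasZeroObject T] [HasShift T ℤ] [Preadditive T]
  [∀ n : ℤ, (shiftFunctor T n).Additive] [Pretriangulated T]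
  {i : TriangleFunctor S T} {q p : TriangleFunctor T S}
  {P Q : ObjectProperty T} [P.IsTriangulated] [Q.IsTriangulated]
  {κ : TriangleFunctor T P.FullSubcategory} {φ : TriangleFunctor T Q.FullSubcategory}

lemma inclusion_full (P : ObjectProperty T) [P.IsTriangulated] :
    (TriangleFunctor.inclusion P).functor.Full := P.fullyFaithfulι.full

lemma inclusion_faithful (P : ObjectProperty T) [P.IsTriangulated] :
    (TriangleFunctor.inclusion P).functor.Faithful := P.fullyFaithfulι.faithful

/-- Given `q ⊣ i ⊣ p` with `i` fully faithful, the kernels of `q` and `p` are equivalent. -/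
lemma isEquivalence_inclusion_comp [i.functor.Full] [i.functor.Faithful]
    (adj : q.functor ⊣ i.functor) (adj' : i.functor ⊣ p.functor)
    (hP : ∀ X, P X ↔ IsZero (p.functor.obj X)) (hQ : ∀ X, Q X ↔ IsZero (q.functor.obj X))
    (adjκ : κ.functor ⊣ (TriangleFunctor.inclusion P).functor)
    (adjφ : (TriangleFunctor.inclusion Q).functor ⊣ φ.functor) :
    ((TriangleFunctor.inclusion Q).functor ⋙ κ.functor).IsEquivalence := by
  have := inclusion_full P
  have := inclusion_faithful P
  have := inclusion_full Q
  have := inclusion_faithful Q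
  -- Both kernels differ from `T` by the image of `i`, which `φ` and `κ` kill: hence `φ` inverts the
  -- unit of `κ`, and `κ` inverts the counit of `φ`.
  have h₁ (X : T) : IsIso (φ.functor.map (adjκ.unit.app X)) := by
    obtain ⟨f, h, hT⟩ := leftAdjoint_inclusion_triangle adj' hP adjκ X
    exact (φ.isIso_map_mor₂_iff _ hT).2 (isZero_rightAdjoint_inclusion_obj adj hQ adjφ _)
  have h₂ (X : T) : IsIso (κ.functor.map (adjφ.counit.app X)) := by
    obtain ⟨f, h, hT⟩ := rightAdjoint_inclusion_triangle adj hQ adjφ X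
    exact (κ.isIso_map_mor₁_iff _ hT).2 (isZero_leftAdjoint_inclusion_obj adj' hP adjκ _)
  let a := adjφ.comp adjκ
  have hu (X) : IsIso (a.unit.app X) := by
    rw [Adjunction.comp_unit_app]
    have := h₁ ((TriangleFunctor.inclusion Q).functor.obj X)
    infer_instance
  have hc (X) : IsIso (a.counit.app X) := by
    rw [Adjunction.comp_counit_app]
    have := h₂ ((TriangleFunctor.inclusion P).functor.obj X)
    infer_instance
  exact a.toEquivalence.isEquivalence_functor

/-- The reflection onto the kernel of `p` has a left adjoint. -/
lemma nonempty_adjunction_left [i.functor.Full] [i.functor.Faithful]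
    (adj : q.functor ⊣ i.functor) (adj' : i.functor ⊣ p.functor)
    (hP : ∀ X, P X ↔ IsZero (p.functor.obj X)) (hQ : ∀ X, Q X ↔ IsZero (q.functor.obj X))
    (adjκ : κ.functor ⊣ (TriangleFunctor.inclusion P).functor)
    (adjφ : (TriangleFunctor.inclusion Q).functor ⊣ φ.functor) :
    Nonempty ((((TriangleFunctor.inclusion P).comp φ).comp
      (TriangleFunctor.inclusion Q)).functor ⊣ κ.functor) := by
  have := isEquivalence_inclusion_comp adj adj' hP hQ adjκ adjφ
  let E := ((TriangleFunctor.inclusion Q).functor ⋙ κ.functor).asEquivalence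
  -- The right adjoint of an equivalence is its quasi-inverse, hence also its left adjoint.
  -- Composing with `adjφ` gives a left adjoint of `φ ⋙ ι_Q ⋙ κ`, which is `κ` because `κ` inverts
  -- the counit of `φ`.
  let b : (TriangleFunctor.inclusion P).functor ⋙ φ.functor ⊣
      (TriangleFunctor.inclusion Q).functor ⋙ κ.functor :=
    E.symm.toAdjunction.ofNatIsoLeft (E.toAdjunction.rightAdjointUniq (adjφ.comp adjκ))
  have h₂ (X : T) : IsIso ((Functor.whiskerRight adjφ.counit κ.functor).app X) := by
    obtain ⟨f, h, hT⟩ := rightAdjoint_inclusion_triangle adj hQ adjφ X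
    exact (κ.isIso_map_mor₁_iff _ hT).2 (isZero_leftAdjoint_inclusion_obj adj' hP adjκ _)
  have := NatIso.isIso_of_isIso_app (Functor.whiskerRight adjφ.counit κ.functor)
  exact ⟨(b.comp adjφ).ofNatIsoRight (asIso (Functor.whiskerRight adjφ.counit κ.functor))⟩

/-- The coreflection onto the kernel of `q` has a right adjoint. -/
lemma nonempty_adjunction_right [i.functor.Full] [i.functor.Faithful]
    (adj : q.functor ⊣ i.functor) (adj' : i.functor ⊣ p.functor)
    (hP : ∀ X, P X ↔ IsZero (p.functor.obj X)) (hQ : ∀ X, Q X ↔ IsZero (q.functor.obj X))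
    (adjκ : κ.functor ⊣ (TriangleFunctor.inclusion P).functor)
    (adjφ : (TriangleFunctor.inclusion Q).functor ⊣ φ.functor) :
    Nonempty (φ.functor ⊣ (((TriangleFunctor.inclusion Q).comp κ).comp
      (TriangleFunctor.inclusion P)).functor) := by
  have := isEquivalence_inclusion_comp adj adj' hP hQ adjκ adjφ
  let E := ((TriangleFunctor.inclusion Q).functor ⋙ κ.functor).asEquivalence
  let b : (TriangleFunctor.inclusion P).functor ⋙ φ.functor ⊣
      (TriangleFunctor.inclusion Q).functor ⋙ κ.functor :=
    E.symm.toAdjunction.ofNatIsoLeft (E.toAdjunction.rightAdjointUniq (adjφ.comp adjκ))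
  -- This identifies `κ ⋙ ι_P ⋙ φ`, the left adjoint produced by composing `adjκ` with `b`, with
  -- `φ`.
  have h₁ (X : T) : IsIso ((Functor.whiskerRight adjκ.unit φ.functor).app X) := by
    obtain ⟨f, h, hT⟩ := leftAdjoint_inclusion_triangle adj' hP adjκ X
    exact (φ.isIso_map_mor₂_iff _ hT).2 (isZero_rightAdjoint_inclusion_obj adj hQ adjφ _)
  have := NatIso.isIso_of_isIso_app (Functor.whiskerRight adjκ.unit φ.functor)
  exact ⟨(adjκ.comp b).ofNatIsoLeft (asIso (Functor.whiskerRight adjκ.unit φ.functor)).symm⟩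

/-- An object is in the essential image of `i` if and only if it is killed by the reflection
onto the kernel of `p`. -/
lemma essImage_iff_isZero_leftAdjoint_inclusion [i.functor.Full] [i.functor.Faithful]
    (adj' : i.functor ⊣ p.functor) (hP : ∀ X, P X ↔ IsZero (p.functor.obj X))
    (adjκ : κ.functor ⊣ (TriangleFunctor.inclusion P).functor) (X : T) :
    i.functor.essImage X ↔ IsZero (κ.functor.obj X) := by
  refine ⟨?_, fun hX => ?_⟩
  · rintro ⟨Y, ⟨e⟩⟩
    exact (isZero_leftAdjoint_inclusion_obj adj' hP adjκ Y).of_iso (κ.functor.mapIso e.symm)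
  · obtain ⟨f, h, hT⟩ := leftAdjoint_inclusion_triangle adj' hP adjκ X
    have : IsIso f := (Pretriangulated.Triangle.isZero₃_iff_isIso₁ _ hT).1
      ((TriangleFunctor.inclusion P).functor.map_isZero hX)
    exact ⟨_, ⟨asIso f⟩⟩

/-- An object is in the essential image of `i` if and only if it is killed by the coreflection
onto the kernel of `q`. -/
lemma essImage_iff_isZero_rightAdjoint_inclusion [i.functor.Full] [i.functor.Faithful]
    (adj : q.functor ⊣ i.functor) (hQ : ∀ X, Q X ↔ IsZero (q.functor.obj X))
    (adjφ : (TriangleFunctor.inclusion Q).functor ⊣ φ.functor) (X : T) :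
    i.functor.essImage X ↔ IsZero (φ.functor.obj X) := by
  refine ⟨?_, fun hX => ?_⟩
  · rintro ⟨Y, ⟨e⟩⟩
    exact (isZero_rightAdjoint_inclusion_obj adj hQ adjφ Y).of_iso (φ.functor.mapIso e.symm)
  · obtain ⟨f, h, hT⟩ := rightAdjoint_inclusion_triangle adj hQ adjφ X
    have : IsIso f := (Pretriangulated.Triangle.isZero₁_iff_isIso₂ _ hT).1
      ((TriangleFunctor.inclusion Q).functor.map_isZero hX)
    exact ⟨_, ⟨(asIso f).symm⟩⟩

namespace TriangulatedRecollement

/-- The recollement of `T` with respect to `q ⊣ i ⊣ p`, `i` fully faithful, and the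
kernel of `p`. -/
noncomputable def ofKernelRight (hi : i.functor.Full) (hi' : i.functor.Faithful)
    (adj : q.functor ⊣ i.functor) (adj' : i.functor ⊣ p.functor)
    (hP : ∀ X, P X ↔ IsZero (p.functor.obj X)) (hQ : ∀ X, Q X ↔ IsZero (q.functor.obj X))
    (adjκ : κ.functor ⊣ (TriangleFunctor.inclusion P).functor)
    (adjφ : (TriangleFunctor.inclusion Q).functor ⊣ φ.functor) :
    TriangulatedRecollement S T P.FullSubcategory :=
  have := inclusion_full P
  have := inclusion_faithful P
  have hl := nonempty_adjunction_left adj adj' hP hQ adjκ adjφ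
  -- In an adjoint triple the outer functors are fully faithful simultaneously, and here the right
  -- one is an inclusion.
  have hff := (Adjunction.Triple.mk hl.some adjκ).fullyFaithfulEquiv.symm (.ofFullyFaithful _)
  { i := i
    q := q
    p := p
    e := κ
    l := ((TriangleFunctor.inclusion P).comp φ).comp (TriangleFunctor.inclusion Q)
    r := TriangleFunctor.inclusion P
    adj_q_i := ⟨adj⟩
    adj_i_p := ⟨adj'⟩
    adj_l_e := hl
    adj_e_r := ⟨adjκ⟩
    i_full := hi
    i_faithful := hi'
    l_full := hff.full
    l_faithful := hff.faithful
    r_full := inclusion_full P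
    r_faithful := inclusion_faithful P
    essImage_i_iff := essImage_iff_isZero_leftAdjoint_inclusion adj' hP adjκ }

/-- The recollement of `T` with respect to `q ⊣ i ⊣ p`, `i` fully faithful, and the
kernel of `q`. -/
noncomputable def ofKernelLeft (hi : i.functor.Full) (hi' : i.functor.Faithful)
    (adj : q.functor ⊣ i.functor) (adj' : i.functor ⊣ p.functor)
    (hP : ∀ X, P X ↔ IsZero (p.functor.obj X)) (hQ : ∀ X, Q X ↔ IsZero (q.functor.obj X))
    (adjκ : κ.functor ⊣ (TriangleFunctor.inclusion P).functor)
    (adjφ : (TriangleFunctor.inclusion Q).functor ⊣ φ.functor) :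
    TriangulatedRecollement S T Q.FullSubcategory :=
  have := inclusion_full Q
  have := inclusion_faithful Q
  have hr := nonempty_adjunction_right adj adj' hP hQ adjκ adjφ
  have hff := (Adjunction.Triple.mk adjφ hr.some).fullyFaithfulEquiv (.ofFullyFaithful _)
  { i := i
    q := q
    p := p
    e := φ
    l := TriangleFunctor.inclusion Q
    r := ((TriangleFunctor.inclusion Q).comp κ).comp (TriangleFunctor.inclusion P)
    adj_q_i := ⟨adj⟩
    adj_i_p := ⟨adj'⟩
    adj_l_e := ⟨adjφ⟩
    adj_e_r := hr
    i_full := hi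
    i_faithful := hi'
    l_full := inclusion_full Q
    l_faithful := inclusion_faithful Q
    r_full := hff.full
    r_faithful := hff.faithful
    essImage_i_iff := essImage_iff_isZero_rightAdjoint_inclusion adj hQ adjφ }

/-- The recollement of `T` with respect to the kernel of a functor `e` which has a left and a
right adjoint, the latter being fully faithful. -/
noncomputable def ofKernelMiddle {l r : TriangleFunctor S T} {e : TriangleFunctor T S}
    (hr : r.functor.Full) (hr' : r.functor.Faithful)
    (adj : l.functor ⊣ e.functor) (adj' : e.functor ⊣ r.functor)
    {κ φ : TriangleFunctor T e.kernel.FullSubcategory}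
    (adjκ : κ.functor ⊣ (TriangleFunctor.inclusion e.kernel).functor)
    (adjφ : (TriangleFunctor.inclusion e.kernel).functor ⊣ φ.functor) :
    TriangulatedRecollement e.kernel.FullSubcategory T S :=
  have hff := (Adjunction.Triple.mk adj adj').fullyFaithfulEquiv.symm (.ofFullyFaithful _)
  { i := TriangleFunctor.inclusion e.kernel
    q := κ
    p := φ
    e := e
    l := l
    r := r
    adj_q_i := ⟨adjκ⟩
    adj_i_p := ⟨adjφ⟩
    adj_l_e := ⟨adj⟩
    adj_e_r := ⟨adj'⟩
    i_full := inclusion_full _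
    i_faithful := inclusion_faithful _
    l_full := hff.full
    l_faithful := hff.faithful
    r_full := hr
    r_faithful := hr'
    essImage_i_iff X := ⟨fun ⟨Y, ⟨a⟩⟩ => e.kernel.prop_of_iso a Y.property,
      fun hX => ⟨⟨X, hX⟩, ⟨Iso.refl X⟩⟩⟩ }

end TriangulatedRecollement

end Bousfield

/-! ### Verdier quotients by the kernel of a localization functor. -/

section Verdier

variable {S : Type u₁} [Category.{v₁} S] [HasZeroObject S] [HasShift S ℤ] [Preadditive S]
  [∀ n : ℤ, (shiftFunctor S n).Additive] [Pretriangulated S] [IsTriangulated S]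
  {T : Type u₂} [Category.{v₂} T] [HasZeroObject T] [HasShift T ℤ] [Preadditive T]
  [∀ n : ℤ, (shiftFunctor T n).Additive] [Pretriangulated T] [IsTriangulated T]

/-- A triangle functor which has a fully faithful right adjoint induces an equivalence from the
Verdier quotient by its kernel. -/
theorem TriangleFunctor.inducesVerdierEquivalence_of_adjunction (F : TriangleFunctor S T)
    {G : T ⥤ S} [G.Full] [G.Faithful] (adj : F.functor ⊣ G) :
    F.InducesVerdierEquivalence := by
  have hW : (MorphismProperty.isomorphisms T).inverseImage F.functor = F.kernel.trW := by
    ext X Y f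
    exact (F.kernel_trW_iff f).symm
  have hF : F.functor.IsLocalization F.kernel.trW := hW ▸ adj.isLocalization
  let L := F.kernel.trW.Q
  have hinv : F.kernel.trW.IsInvertedBy F.functor := Localization.inverts _ _
  let E := Localization.lift F.functor hinv L
  let : E.CommShift ℤ := Functor.commShiftOfLocalization L F.kernel.trW ℤ F.functor E
  have hcomm : NatTrans.CommShift (Localization.Lifting.iso L F.kernel.trW F.functor E).hom ℤ :=
    NatTrans.commShift_iso_hom_of_localization ..
  -- Every arrow of the quotient is isomorphic to the image of an arrow of `S`, so whether `E` is
  -- triangulated can be tested after precomposition with `L`, where it becomes `F`.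
  have : L.mapArrow.EssSurj := Localization.essSurj_mapArrow L F.kernel.trW
  have hE : E.IsTriangulated := Functor.isTriangulated_of_precomp_iso
    (Localization.Lifting.iso L F.kernel.trW F.functor E)
  refine ⟨⟨E, inferInstance, hE⟩, ?_, Localization.Lifting.iso L F.kernel.trW F.functor E, hcomm⟩
  exact Functor.isEquivalence_of_iso (Localization.isoUniqFunctor L F.functor F.kernel.trW E
    (Localization.Lifting.iso L F.kernel.trW F.functor E)).symm

end Verdier

/-! ### Restriction of adjunctions and recollements to triangulated subcategories. -/

section Restrict

variable {S : Type u₁} [Category.{v₁} S] [HasZeroObject S] [HasShift S ℤ] [Preadditive S]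
  [∀ n : ℤ, (shiftFunctor S n).Additive] [Pretriangulated S]
  {T : Type u₂} [Category.{v₂} T] [HasZeroObject T] [HasShift T ℤ] [Preadditive T]
  [∀ n : ℤ, (shiftFunctor T n).Additive] [Pretriangulated T]
  {U : Type u₃} [Category.{v₃} U] [HasZeroObject U] [HasShift U ℤ] [Preadditive U]
  [∀ n : ℤ, (shiftFunctor U n).Additive] [Pretriangulated U]

namespace TriangleFunctor

variable {F : TriangleFunctor S T} {G : TriangleFunctor T S} {P : ObjectProperty S}
  {Q : ObjectProperty T} [P.IsTriangulated] [Q.IsTriangulated]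

/-- The restriction of an adjunction to full triangulated subcategories. -/
noncomputable def restrictAdjunction (adj : F.functor ⊣ G.functor)
    (hF : ∀ X, P X → Q (F.functor.obj X)) (hG : ∀ X, Q X → P (G.functor.obj X)) :
    (F.restrict P Q hF).functor ⊣ (G.restrict Q P hG).functor :=
  adj.restrictFullyFaithful P.fullyFaithfulι Q.fullyFaithfulι (Iso.refl _) (Iso.refl _)

/-- The restriction of a fully faithful functor is fully faithful. -/
noncomputable def restrictFullyFaithful (hF : F.functor.Full) (hF' : F.functor.Faithful)
    (h : ∀ X, P X → Q (F.functor.obj X)) : (F.restrict P Q h).functor.FullyFaithful :=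
  Functor.FullyFaithful.ofCompFaithful (G := Q.ι)
    (P.fullyFaithfulι.comp (Functor.FullyFaithful.ofFullyFaithful F.functor))

end TriangleFunctor

namespace TriangulatedRecollement

/-- A recollement restricts to full triangulated subcategories which are preserved by the six
functors. -/
theorem restrictsTo (R : TriangulatedRecollement S T U) (PS : ObjectProperty S)
    [PS.IsTriangulated] (PT : ObjectProperty T) [PT.IsTriangulated] (PU : ObjectProperty U)
    [PU.IsTriangulated]
    (hi : ∀ X, PS X → PT (R.i.functor.obj X)) (hq : ∀ X, PT X → PS (R.q.functor.obj X))
    (hp : ∀ X, PT X → PS (R.p.functor.obj X)) (he : ∀ X, PT X → PU (R.e.functor.obj X))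
    (hl : ∀ X, PU X → PT (R.l.functor.obj X)) (hr : ∀ X, PU X → PT (R.r.functor.obj X)) :
    R.RestrictsTo PS PT PU := by
  have hi₀ := TriangleFunctor.restrictFullyFaithful R.i_full R.i_faithful hi
  have hl₀ := TriangleFunctor.restrictFullyFaithful R.l_full R.l_faithful hl
  have hr₀ := TriangleFunctor.restrictFullyFaithful R.r_full R.r_faithful hr
  refine ⟨hi, hq, hp, he, hl, hr,
    { i := R.i.restrict PS PT hi
      q := R.q.restrict PT PS hq
      p := R.p.restrict PT PS hp
      e := R.e.restrict PT PU he
      l := R.l.restrict PU PT hl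
      r := R.r.restrict PU PT hr
      adj_q_i := R.adj_q_i.map fun adj => TriangleFunctor.restrictAdjunction adj hq hi
      adj_i_p := R.adj_i_p.map fun adj => TriangleFunctor.restrictAdjunction adj hi hp
      adj_l_e := R.adj_l_e.map fun adj => TriangleFunctor.restrictAdjunction adj hl he
      adj_e_r := R.adj_e_r.map fun adj => TriangleFunctor.restrictAdjunction adj he hr
      i_full := hi₀.full
      i_faithful := hi₀.faithful
      l_full := hl₀.full
      l_faithful := hl₀.faithful
      r_full := hr₀.full
      r_faithful := hr₀.faithful
      essImage_i_iff := fun X => ?_ }, rfl, rfl, rfl, rfl, rfl, rfl⟩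
  have hX : IsZero ((R.e.restrict PT PU he).functor.obj X) ↔
      IsZero (R.e.functor.obj X.obj) :=
    ⟨fun h => PU.ι.map_isZero h, fun h => .of_full_of_faithful_of_isZero PU.ι _ h⟩
  rw [hX, ← R.essImage_i_iff]
  constructor
  · rintro ⟨Y, ⟨a⟩⟩
    exact ⟨Y.obj, ⟨PT.ι.mapIso a⟩⟩
  · rintro ⟨Y, ⟨a⟩⟩
    -- The given preimage `Y` need not lie in `PS`. It is replaced by `p X`, which does by `hp`, and
    -- the counit `i p X ⟶ X` is invertible because `X` is in the essential image of `i`.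
    obtain ⟨adj⟩ := R.adj_i_p
    have := R.i_full
    have := R.i_faithful
    have hu : IsIso (adj.counit.app X.obj) := adj.isIso_counit_app_of_iso a.symm
    exact ⟨⟨R.p.functor.obj X.obj, hp _ X.property⟩,
      ⟨PT.fullyFaithfulι.preimageIso (@asIso _ _ _ _ _ hu)⟩⟩

end TriangulatedRecollement

end Restrict

/-! ### Adjunctions on localizations and Verdier quotients. -/

/-- If the counit of an adjunction is an isomorphism, the same holds for the adjunction which it
induces on localizations. -/
lemma isIso_localization_counit {C₁ C₂ D₁ D₂ : Type*} [Category* C₁] [Category* C₂]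
    [Category* D₁] [Category* D₂] {G : C₁ ⥤ C₂} {F : C₂ ⥤ C₁} (adj : G ⊣ F)
    (L₁ : C₁ ⥤ D₁) (W₁ : MorphismProperty C₁) [L₁.IsLocalization W₁]
    (L₂ : C₂ ⥤ D₂) (W₂ : MorphismProperty C₂) [L₂.IsLocalization W₂]
    (G' : D₁ ⥤ D₂) (F' : D₂ ⥤ D₁) [CatCommSq G L₁ L₂ G'] [CatCommSq F L₂ L₁ F']
    [IsIso adj.counit] : IsIso (adj.localization L₁ W₁ L₂ W₂ G' F').counit := by
  -- On objects coming from `C₂` the counit is the image of the original one up to the comparison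
  -- isomorphisms; essential surjectivity of `L₂` covers the other objects.
  have h (X : C₂) : IsIso ((adj.localization L₁ W₁ L₂ W₂ G' F').counit.app (L₂.obj X)) := by
    rw [Adjunction.localization_counit_app]
    infer_instance
  have := Localization.essSurj L₂ W₂
  refine @NatIso.isIso_of_isIso_app _ _ _ _ _ _ _ fun Y => ?_
  exact (NatTrans.isIso_app_iff_of_iso _ (L₂.objObjPreimageIso Y)).1 (h _)

section Quotients

variable {S : Type u₁} [Category.{v₁} S] [HasZeroObject S] [HasShift S ℤ] [Preadditive S]
  [∀ n : ℤ, (shiftFunctor S n).Additive] [Pretriangulated S] [IsTriangulated S]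
  {T : Type u₂} [Category.{v₂} T] [HasZeroObject T] [HasShift T ℤ] [Preadditive T]
  [∀ n : ℤ, (shiftFunctor T n).Additive] [Pretriangulated T] [IsTriangulated T]
  {F : TriangleFunctor S T} {G : TriangleFunctor T S} {P : ObjectProperty S}
  {Q : ObjectProperty T} [P.IsTriangulated] [Q.IsTriangulated]

namespace TriangleFunctor

/-- The adjunction between Verdier quotients which is induced by an adjunction. -/
noncomputable def quotientAdjunction (adj : F.functor ⊣ G.functor)
    (hF : ∀ X, P X → Q (F.functor.obj X)) (hG : ∀ X, Q X → P (G.functor.obj X)) :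
    (F.onQuotients P Q hF).functor ⊣ (G.onQuotients Q P hG).functor :=
  letI : CatCommSq F.functor P.trW.Q Q.trW.Q (F.onQuotients P Q hF).functor :=
    (F.localizerMorphism P Q hF).catCommSq P.trW.Q Q.trW.Q
  letI : CatCommSq G.functor Q.trW.Q P.trW.Q (G.onQuotients Q P hG).functor :=
    (G.localizerMorphism Q P hG).catCommSq Q.trW.Q P.trW.Q
  adj.localization P.trW.Q P.trW Q.trW.Q Q.trW _ _

lemma isIso_quotientAdjunction_counit (adj : F.functor ⊣ G.functor) [IsIso adj.counit]
    (hF : ∀ X, P X → Q (F.functor.obj X)) (hG : ∀ X, Q X → P (G.functor.obj X)) :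
    IsIso (quotientAdjunction adj hF hG).counit :=
  letI : CatCommSq F.functor P.trW.Q Q.trW.Q (F.onQuotients P Q hF).functor :=
    (F.localizerMorphism P Q hF).catCommSq P.trW.Q Q.trW.Q
  letI : CatCommSq G.functor Q.trW.Q P.trW.Q (G.onQuotients Q P hG).functor :=
    (G.localizerMorphism Q P hG).catCommSq Q.trW.Q P.trW.Q
  isIso_localization_counit adj P.trW.Q P.trW Q.trW.Q Q.trW _ _

end TriangleFunctor

end Quotients

/-! ### Adjunctions on derived and singularity categories. -/

section Derived

variable {B : Type u₂} [Category.{v₂} B] [Abelian B] [HasDerivedCategory.{w₁} B]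
  {C : Type u₃} [Category.{v₃} C] [Abelian C] [HasDerivedCategory.{w₂} C]

/-- The adjunction between categories of complexes induced by an adjunction. -/
def mapHomologicalComplexAdjunction {F : B ⥤ C} {G : C ⥤ B} [F.Additive] [G.Additive]
    (adj : F ⊣ G) {ι : Type*} (c : ComplexShape ι) :
    F.mapHomologicalComplex c ⊣ G.mapHomologicalComplex c :=
  Adjunction.mkOfUnitCounit
    { unit :=
        { app := fun K =>
            { f := fun n => adj.unit.app (K.X n)
              comm' := fun i j _ => (adj.unit.naturality (K.d i j)).symm }
          naturality := fun _ _ f => by ext n; exact adj.unit.naturality (f.f n) }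
      counit :=
        { app := fun K =>
            { f := fun n => adj.counit.app (K.X n)
              comm' := fun i j _ => (adj.counit.naturality (K.d i j)).symm }
          naturality := fun _ _ f => by ext n; exact adj.counit.naturality (f.f n) }
      left_triangle := by
        ext K n
        simp only [NatTrans.comp_app, HomologicalComplex.comp_f]
        exact (congrArg _ (Category.id_comp _)).trans (adj.left_triangle_components (K.X n))
      right_triangle := by
        ext K n
        simp only [NatTrans.comp_app, HomologicalComplex.comp_f]
        exact (congrArg _ (Category.id_comp _)).trans (adj.right_triangle_components (K.X n)) }

/-- The adjunction between derived categories induced by an adjunction between exact functors. -/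
noncomputable def derivedAdjunction {F : B ⥤ C} {G : C ⥤ B} (adj : F ⊣ G) (hF : IsExact F)
    (hG : IsExact G) : (derivedFunctor F hF).functor ⊣ (derivedFunctor G hG).functor :=
  have := hF.additive
  have := hF.preservesFiniteLimits
  have := hF.preservesFiniteColimits
  have := hG.additive
  have := hG.preservesFiniteLimits
  have := hG.preservesFiniteColimits
  letI : CatCommSq (F.mapHomologicalComplex (.up ℤ)) DerivedCategory.Q DerivedCategory.Q
      (derivedFunctor F hF).functor := ⟨F.mapDerivedCategoryFactors.symm⟩
  letI : CatCommSq (G.mapHomologicalComplex (.up ℤ)) DerivedCategory.Q DerivedCategory.Q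
      (derivedFunctor G hG).functor := ⟨G.mapDerivedCategoryFactors.symm⟩
  (mapHomologicalComplexAdjunction adj (.up ℤ)).localization
    DerivedCategory.Q (HomologicalComplex.quasiIso B (.up ℤ))
    DerivedCategory.Q (HomologicalComplex.quasiIso C (.up ℤ)) _ _

/-- The counit on complexes is the original one in each degree. Full faithfulness of `G` thus passes
to `D` without any comparison of Ext groups. -/
lemma isIso_derivedAdjunction_counit {F : B ⥤ C} {G : C ⥤ B} (adj : F ⊣ G) (hF : IsExact F)
    (hG : IsExact G) [IsIso adj.counit] : IsIso (derivedAdjunction adj hF hG).counit := by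
  have := hF.additive
  have := hF.preservesFiniteLimits
  have := hF.preservesFiniteColimits
  have := hG.additive
  have := hG.preservesFiniteLimits
  have := hG.preservesFiniteColimits
  have (K : CochainComplex C ℤ) :
      IsIso ((mapHomologicalComplexAdjunction adj (.up ℤ)).counit.app K) := by
    have (n : ℤ) :
        IsIso (((mapHomologicalComplexAdjunction adj (.up ℤ)).counit.app K).f n) :=
      inferInstanceAs (IsIso (adj.counit.app (K.X n)))
    exact HomologicalComplex.Hom.isIso_of_components _
  have := NatIso.isIso_of_isIso_app (mapHomologicalComplexAdjunction adj (.up ℤ)).counit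
  exact
    letI : CatCommSq (F.mapHomologicalComplex (.up ℤ)) DerivedCategory.Q DerivedCategory.Q
        (derivedFunctor F hF).functor := ⟨F.mapDerivedCategoryFactors.symm⟩
    letI : CatCommSq (G.mapHomologicalComplex (.up ℤ)) DerivedCategory.Q DerivedCategory.Q
        (derivedFunctor G hG).functor := ⟨G.mapDerivedCategoryFactors.symm⟩
    isIso_localization_counit (mapHomologicalComplexAdjunction adj (.up ℤ))
      DerivedCategory.Q (HomologicalComplex.quasiIso B (.up ℤ))
      DerivedCategory.Q (HomologicalComplex.quasiIso C (.up ℤ)) _ _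

/-- The adjunction between bounded derived categories induced by an adjunction between exact
functors. -/
noncomputable def boundedDerivedAdjunction {F : B ⥤ C} {G : C ⥤ B} (adj : F ⊣ G)
    (hF : IsExact F) (hG : IsExact G) :
    (boundedDerivedFunctor F hF).functor ⊣ (boundedDerivedFunctor G hG).functor :=
  TriangleFunctor.restrictAdjunction (derivedAdjunction adj hF hG) _ _

lemma isIso_boundedDerivedAdjunction_counit {F : B ⥤ C} {G : C ⥤ B} (adj : F ⊣ G)
    (hF : IsExact F) (hG : IsExact G) [IsIso adj.counit] :
    IsIso (boundedDerivedAdjunction adj hF hG).counit := by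
  have := isIso_derivedAdjunction_counit adj hF hG
  -- Full faithfulness restricts directly to subcategories and then returns the invertible counit,
  -- so the counit of the restricted adjunction need not be computed.
  have hG₀ := (derivedAdjunction adj hF hG).fullyFaithfulROfIsIsoCounit
  have hG₁ := TriangleFunctor.restrictFullyFaithful hG₀.full hG₀.faithful
    (bounded_derivedFunctor G hG)
  have : (boundedDerivedFunctor G hG).functor.Full := hG₁.full
  have : (boundedDerivedFunctor G hG).functor.Faithful := hG₁.faithful
  infer_instance

/-- The adjunction between singularity categories induced by an adjunction between exact
functors which preserve projective objects. -/
noncomputable def singularityAdjunction {F : B ⥤ C} {G : C ⥤ B} (adj : F ⊣ G)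
    (hF : IsExact F) (hG : IsExact G) (hF' : F.PreservesProjectiveObjects)
    (hG' : G.PreservesProjectiveObjects) :
    (singularityFunctor F hF hF').functor ⊣ (singularityFunctor G hG hG').functor :=
  TriangleFunctor.quotientAdjunction (boundedDerivedAdjunction adj hF hG) _ _

lemma isIso_singularityAdjunction_counit {F : B ⥤ C} {G : C ⥤ B} (adj : F ⊣ G)
    (hF : IsExact F) (hG : IsExact G) (hF' : F.PreservesProjectiveObjects)
    (hG' : G.PreservesProjectiveObjects) [IsIso adj.counit] :
    IsIso (singularityAdjunction adj hF hG hF' hG').counit := by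
  have := isIso_boundedDerivedAdjunction_counit adj hF hG
  exact TriangleFunctor.isIso_quotientAdjunction_counit _ _ _

variable {A : Type u₁} [Category.{v₁} A] [Abelian A]

lemma isZero_derivedCategory_iff (X : DerivedCategory C) :
    IsZero X ↔ ∀ n : ℤ, IsZero ((DerivedCategory.homologyFunctor C n).obj X) := by
  refine ⟨fun h n => (DerivedCategory.homologyFunctor C n).map_isZero h, fun h => ?_⟩
  have : IsIso (0 : X ⟶ 0) := (DerivedCategory.isIso_iff C _).2 fun n =>
    ⟨0, (h n).eq_of_src _ _,
      ((DerivedCategory.homologyFunctor C n).map_isZero (isZero_zero _)).eq_of_src _ _⟩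
  exact (isZero_zero _).of_iso (asIso (0 : X ⟶ 0))

/-- The functor on derived categories induced by an exact functor commutes with homology. -/
lemma nonempty_homology_derivedFunctor_iso {F : B ⥤ C} (hF : IsExact F) (X : DerivedCategory B)
    (n : ℤ) : Nonempty ((DerivedCategory.homologyFunctor C n).obj
      ((derivedFunctor F hF).functor.obj X) ≅
        F.obj ((DerivedCategory.homologyFunctor B n).obj X)) := by
  have := hF.additive
  have := hF.preservesFiniteLimits
  have := hF.preservesFiniteColimits
  let K := DerivedCategory.Q.objPreimage X
  let e : DerivedCategory.Q.obj K ≅ X := DerivedCategory.Q.objObjPreimageIso X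
  let e' : F.mapDerivedCategory.obj X ≅
      DerivedCategory.Q.obj ((F.mapHomologicalComplex (.up ℤ)).obj K) :=
    F.mapDerivedCategory.mapIso e.symm ≪≫ F.mapDerivedCategoryFactors.app K
  let a : HomologicalComplex.homology ((F.mapHomologicalComplex (.up ℤ)).obj K) n ≅
      F.obj (K.homology n) := (K.sc n).mapHomologyIso F
  exact ⟨(DerivedCategory.homologyFunctor C n).mapIso e' ≪≫
    (DerivedCategory.homologyFunctorFactors C n).app _ ≪≫ a ≪≫
    F.mapIso (((DerivedCategory.homologyFunctorFactors B n).app K).symm ≪≫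
      (DerivedCategory.homologyFunctor B n).mapIso e)⟩

/-- Exactness of `e` gives `Hⁿ(e X) ≅ e (Hⁿ X)`. This presents `D_A(B)` as the kernel of the right
adjoint in the triple `(l¹, l, e)`, the form required by `ofKernelRight`. -/
lemma cohomologyIn_iff (R : AbelianRecollement A B C) (X : DerivedCategory B) :
    cohomologyIn R X ↔ IsZero ((derivedFunctor R.e R.exact_e).functor.obj X) := by
  rw [isZero_derivedCategory_iff]
  refine forall_congr' fun n => (R.essImage_i_iff _).trans ?_
  exact (nonempty_homology_derivedFunctor_iso R.exact_e X n).some.symm.isZero_iff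

end Derived

/-! ### The recollements and equivalences attached to a ladder. -/

section

variable {A : Type u₁} [Category.{v₁} A] [Abelian A]
  {B : Type u₂} [Category.{v₂} B] [Abelian B] [HasDerivedCategory.{w₁} B]
  {C : Type u₃} [Category.{v₃} C] [Abelian C] [HasDerivedCategory.{w₂} C]
  {R : AbelianRecollement A B C}

/-- An adjunction `F ⊣ G` with `G` fully faithful induces a fully faithful functor between
singularity categories. -/
noncomputable def singularityFunctorFullyFaithful {F : B ⥤ C} {G : C ⥤ B} (adj : F ⊣ G)
    (hF : IsExact F) (hG : IsExact G) (hF' : F.PreservesProjectiveObjects)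
    (hG' : G.PreservesProjectiveObjects) (h : G.Full) (h' : G.Faithful) :
    (singularityFunctor G hG hG').functor.FullyFaithful :=
  have := isIso_singularityAdjunction_counit adj hF hG hF' hG'
  (singularityAdjunction adj hF hG hF' hG').fullyFaithfulROfIsIsoCounit

/-- Serves both Verdier equivalences, with `F ⊣ G` being `l¹ ⊣ l` or `e ⊣ r`. -/
theorem inducesVerdierEquivalence_singularityFunctor {F : B ⥤ C} {G : C ⥤ B} (adj : F ⊣ G)
    (hF : IsExact F) (hG : IsExact G) (hF' : F.PreservesProjectiveObjects)
    (hG' : G.PreservesProjectiveObjects) (h : G.Full) (h' : G.Faithful) :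
    (singularityFunctor F hF hF').InducesVerdierEquivalence :=
  have hff := singularityFunctorFullyFaithful adj hF hG hF' hG' h h'
  have := hff.full
  have := hff.faithful
  TriangleFunctor.inducesVerdierEquivalence_of_adjunction _
    (singularityAdjunction adj hF hG hF' hG')

theorem LeftLadderThree.exists_derived_recollement (L : LeftLadderThree R) :
    ∃ S : TriangulatedRecollement (DerivedCategory C) (DerivedCategory B)
        (cohomologyIn R).FullSubcategory,
      S.q = derivedFunctor L.l₁ L.exact_l₁ ∧
      S.i = derivedFunctor R.l L.exact_l ∧
      S.p = derivedFunctor R.e R.exact_e ∧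
      S.r = TriangleFunctor.inclusion (cohomologyIn R) ∧
      S.RestrictsTo (bounded C) (bounded B) ((bounded B).inverseImage (cohomologyIn R).ι) := by
  have := R.l_full
  have := R.l_faithful
  have := isIso_derivedAdjunction_counit L.adj₁ L.exact_l₁ L.exact_l
  let adj := derivedAdjunction L.adj₁ L.exact_l₁ L.exact_l
  let adj' := derivedAdjunction R.adj_l_e L.exact_l R.exact_e
  have hff := adj.fullyFaithfulROfIsIsoCounit
  have hi := hff.full
  have hi' := hff.faithful
  have hP := cohomologyIn_iff R
  have hQ (X) : (derivedFunctor L.l₁ L.exact_l₁).kernel X ↔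
    IsZero ((derivedFunctor L.l₁ L.exact_l₁).functor.obj X) := Iff.rfl
  obtain ⟨κ, ⟨adjκ⟩⟩ := exists_leftAdjoint_inclusion adj' (cohomologyIn R) hP
  obtain ⟨φ, ⟨adjφ⟩⟩ := exists_rightAdjoint_inclusion adj _ hQ
  refine ⟨.ofKernelRight hi hi' adj adj' hP hQ adjκ adjφ, rfl, rfl, rfl, rfl, ?_⟩
  refine TriangulatedRecollement.restrictsTo _ _ _ _
    (bounded_derivedFunctor R.l L.exact_l) (bounded_derivedFunctor L.l₁ L.exact_l₁)
    (bounded_derivedFunctor R.e R.exact_e) (fun X hX => ?_) (fun X hX => ?_) (fun X hX => hX)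
  -- Two terms of `l e X ⟶ X ⟶ κ X` are bounded, hence so is the third. The next case uses `φ X ⟶ X
  -- ⟶ l l¹ X` in the same way.
  · obtain ⟨f, h, hT⟩ := leftAdjoint_inclusion_triangle adj' hP adjκ X
    exact (bounded B).ext_of_isTriangulatedClosed₃ _ hT
      (bounded_derivedFunctor R.l L.exact_l _ (bounded_derivedFunctor R.e R.exact_e _ hX)) hX
  · obtain ⟨f, h, hT⟩ := rightAdjoint_inclusion_triangle adj hQ adjφ X.obj
    exact (bounded B).ext_of_isTriangulatedClosed₁ _ hT hX
      (bounded_derivedFunctor R.l L.exact_l _ (bounded_derivedFunctor L.l₁ L.exact_l₁ _ hX))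

/-- The recollement of the singularity category in which the left adjoint of the coreflection
`φ` onto the kernel of `l₁` is the inclusion. -/
theorem LeftLadderThree.exists_singularity_recollement (L : LeftLadderThree R)
    (M : RightLadderTwo R)
    {φ : TriangleFunctor (SingularityCategory B)
      (singularityFunctor L.l₁ L.exact_l₁ L.proj_l₁).kernel.FullSubcategory}
    (adjφ : (TriangleFunctor.inclusion
      (singularityFunctor L.l₁ L.exact_l₁ L.proj_l₁).kernel).functor ⊣ φ.functor) :
    ∃ S : TriangulatedRecollement (SingularityCategory C) (SingularityCategory B)
        (singularityFunctor L.l₁ L.exact_l₁ L.proj_l₁).kernel.FullSubcategory,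
      S.q = singularityFunctor L.l₁ L.exact_l₁ L.proj_l₁ ∧
      S.i = singularityFunctor R.l L.exact_l L.proj_l ∧
      S.p = singularityFunctor R.e R.exact_e M.proj_e ∧
      S.l = TriangleFunctor.inclusion (singularityFunctor L.l₁ L.exact_l₁ L.proj_l₁).kernel ∧
      S.e = φ := by
  let adj := singularityAdjunction L.adj₁ L.exact_l₁ L.exact_l L.proj_l₁ L.proj_l
  let adj' := singularityAdjunction R.adj_l_e L.exact_l R.exact_e L.proj_l M.proj_e
  have hff := singularityFunctorFullyFaithful L.adj₁ L.exact_l₁ L.exact_l L.proj_l₁ L.proj_l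
    R.l_full R.l_faithful
  have hi := hff.full
  have hi' := hff.faithful
  have hP (X) : (singularityFunctor R.e R.exact_e M.proj_e).kernel X ↔
    IsZero ((singularityFunctor R.e R.exact_e M.proj_e).functor.obj X) := Iff.rfl
  have hQ (X) : (singularityFunctor L.l₁ L.exact_l₁ L.proj_l₁).kernel X ↔
    IsZero ((singularityFunctor L.l₁ L.exact_l₁ L.proj_l₁).functor.obj X) := Iff.rfl
  obtain ⟨κ, ⟨adjκ⟩⟩ := exists_leftAdjoint_inclusion adj' _ hP
  exact ⟨.ofKernelLeft hi hi' adj adj' hP hQ adjκ adjφ, rfl, rfl, rfl, rfl, rfl⟩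

/-- The kernel of `l₁` on the singularity category is coreflective. -/
lemma LeftLadderThree.exists_coreflection (L : LeftLadderThree R) :
    ∃ φ : TriangleFunctor (SingularityCategory B)
      (singularityFunctor L.l₁ L.exact_l₁ L.proj_l₁).kernel.FullSubcategory,
      Nonempty ((TriangleFunctor.inclusion
        (singularityFunctor L.l₁ L.exact_l₁ L.proj_l₁).kernel).functor ⊣ φ.functor) := by
  have hff := singularityFunctorFullyFaithful L.adj₁ L.exact_l₁ L.exact_l L.proj_l₁ L.proj_l
    R.l_full R.l_faithful
  have := hff.full
  have := hff.faithful
  exact exists_rightAdjoint_inclusion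
    (singularityAdjunction L.adj₁ L.exact_l₁ L.exact_l L.proj_l₁ L.proj_l) _ fun _ => Iff.rfl

/-- With `l²` available on `D_sg`, the kernel of `l¹` is reflective through `l² ⊣ l¹` as well as
coreflective through `l¹ ⊣ l`. -/
theorem LeftLadderFour.exists_singularity_recollement (L : LeftLadderFour R) :
    ∃ S : TriangulatedRecollement
        (singularityFunctor L.l₁ L.exact_l₁ L.proj_l₁).kernel.FullSubcategory
        (SingularityCategory B) (SingularityCategory C),
      S.i = TriangleFunctor.inclusion (singularityFunctor L.l₁ L.exact_l₁ L.proj_l₁).kernel ∧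
      S.l = singularityFunctor L.l₂ L.exact_l₂ L.proj_l₂ ∧
      S.e = singularityFunctor L.l₁ L.exact_l₁ L.proj_l₁ ∧
      S.r = singularityFunctor R.l L.exact_l L.proj_l ∧
      ∀ M : RightLadderTwo R,
        ∃ S' : TriangulatedRecollement (SingularityCategory C) (SingularityCategory B)
            (singularityFunctor L.l₁ L.exact_l₁ L.proj_l₁).kernel.FullSubcategory,
          S.IsContinuedDownwardsBy S' ∧
          S'.p = singularityFunctor R.e R.exact_e M.proj_e := by
  let adj := singularityAdjunction L.adj₁ L.exact_l₁ L.exact_l L.proj_l₁ L.proj_l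
  let adj₂ := singularityAdjunction L.adj₂ L.exact_l₂ L.exact_l₁ L.proj_l₂ L.proj_l₁
  have hff := singularityFunctorFullyFaithful L.adj₁ L.exact_l₁ L.exact_l L.proj_l₁ L.proj_l
    R.l_full R.l_faithful
  have hff₂ := (Adjunction.Triple.mk adj₂ adj).fullyFaithfulEquiv.symm hff
  have := hff₂.full
  have := hff₂.faithful
  -- The coreflection is fixed once, before `M`: the continuation requires the functor `p` of one
  -- recollement to be equal, not merely isomorphic, to the functor `e` of the other.
  obtain ⟨φ, ⟨adjφ⟩⟩ := L.exists_coreflection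
  obtain ⟨κ, ⟨adjκ⟩⟩ := exists_leftAdjoint_inclusion adj₂
    (singularityFunctor L.l₁ L.exact_l₁ L.proj_l₁).kernel fun _ => Iff.rfl
  refine ⟨.ofKernelMiddle hff.full hff.faithful adj₂ adj adjκ adjφ, rfl, rfl, rfl, rfl,
    fun M => ?_⟩
  obtain ⟨S', hq, hi, hp, hl, he⟩ := L.toLeftLadderThree.exists_singularity_recollement M adjφ
  exact ⟨S', ⟨hq, hi, hl, he⟩, hp⟩

end

/-- The role of `r²` is to make `r¹` exact, so that `r` acts on singularity categories and `e ⊣ r`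
descends to them. -/
lemma RightLadderThree.proj_r {A : Type u₁} [Category.{v₁} A] [Abelian A]
    {B : Type u₂} [Category.{v₂} B] [Abelian B] {C : Type u₃} [Category.{v₃} C] [Abelian C]
    {R : AbelianRecollement A B C} (M : RightLadderThree R) : R.r.PreservesProjectiveObjects :=
  (IsExact.of_adj M.adj₁ M.adj₂).preservesProjectiveObjects M.adj₁

end LadderRecollement

theorem theorem4
    {A : Type u₁} [Category.{v₁} A] [Abelian A]
    {B : Type u₂} [Category.{v₂} B] [Abelian B] [HasDerivedCategory.{w₁} B]
    {C : Type u₃} [Category.{v₃} C] [Abelian C] [HasDerivedCategory.{w₂} C]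
    (R : AbelianRecollement A B C) :
    -- (i) `l`-height three
    (∀ L : LeftLadderThree R,
      (singularityFunctor L.l₁ L.exact_l₁ L.proj_l₁).InducesVerdierEquivalence ∧
      ∃ S : TriangulatedRecollement (DerivedCategory C) (DerivedCategory B)
          (cohomologyIn R).FullSubcategory,
        S.q = derivedFunctor L.l₁ L.exact_l₁ ∧
        S.i = derivedFunctor R.l L.exact_l ∧
        S.p = derivedFunctor R.e R.exact_e ∧
        S.r = TriangleFunctor.inclusion (cohomologyIn R) ∧
        S.RestrictsTo (bounded C) (bounded B) ((bounded B).inverseImage (cohomologyIn R).ι)) ∧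
    -- (ii) `l`-height three and `r`-height two
    (∀ (L : LeftLadderThree R) (M : RightLadderTwo R),
      ∃ S : TriangulatedRecollement (SingularityCategory C) (SingularityCategory B)
          (singularityFunctor L.l₁ L.exact_l₁ L.proj_l₁).kernel.FullSubcategory,
        S.q = singularityFunctor L.l₁ L.exact_l₁ L.proj_l₁ ∧
        S.i = singularityFunctor R.l L.exact_l L.proj_l ∧
        S.p = singularityFunctor R.e R.exact_e M.proj_e ∧
        S.l = TriangleFunctor.inclusion (singularityFunctor L.l₁ L.exact_l₁ L.proj_l₁).kernel) ∧
    -- (iii) `l`-height four, and moreover `r`-height two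
    (∀ L : LeftLadderFour R,
      ∃ S : TriangulatedRecollement
          (singularityFunctor L.l₁ L.exact_l₁ L.proj_l₁).kernel.FullSubcategory
          (SingularityCategory B) (SingularityCategory C),
        S.i = TriangleFunctor.inclusion (singularityFunctor L.l₁ L.exact_l₁ L.proj_l₁).kernel ∧
        S.l = singularityFunctor L.l₂ L.exact_l₂ L.proj_l₂ ∧
        S.e = singularityFunctor L.l₁ L.exact_l₁ L.proj_l₁ ∧
        S.r = singularityFunctor R.l L.exact_l L.proj_l ∧
        ∀ M : RightLadderTwo R,
          ∃ S' : TriangulatedRecollement (SingularityCategory C) (SingularityCategory B)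
              (singularityFunctor L.l₁ L.exact_l₁ L.proj_l₁).kernel.FullSubcategory,
            S.IsContinuedDownwardsBy S' ∧
            S'.p = singularityFunctor R.e R.exact_e M.proj_e) ∧
    -- (iv) `r`-height three
    (∀ M : RightLadderThree R,
      (singularityFunctor R.e R.exact_e M.proj_e).InducesVerdierEquivalence) := by
  refine ⟨fun L => ⟨?_, L.exists_derived_recollement⟩, fun L M => ?_,
    fun L => L.exists_singularity_recollement, fun M => ?_⟩
  · exact inducesVerdierEquivalence_singularityFunctor L.adj₁ L.exact_l₁ L.exact_l L.proj_l₁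
      L.proj_l R.l_full R.l_faithful
  · obtain ⟨φ, ⟨adjφ⟩⟩ := L.exists_coreflection
    obtain ⟨S, hq, hi, hp, hl, -⟩ := L.exists_singularity_recollement M adjφ
    exact ⟨S, hq, hi, hp, hl⟩
  · exact inducesVerdierEquivalence_singularityFunctor R.adj_e_r R.exact_e M.exact_r M.proj_e
      M.proj_r R.r_full R.r_faithful
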